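/- **Theorem (spectrum of the area operator).** Let $\Lambda\in\mathbb R\setminus\{0\}$, $q=e^{i\theta}$ with $\theta\in(0,2\pi)$, $q^x:=e^{i\theta x}$ for real $x$, and $[x]_q:=\frac{q^x-q^{-x}}{q-q^{-1}}$ (at $q=-1$ quotients with denominator $0$ are read as $0$). Let $\mathcal U_q(\mathfrak{su}(2))$ be generated by $q^{\pm H/2},X,Y$ with $q^{H/2}Xq^{-H/2}=qX$, $q^{H/2}Yq^{-H/2}=q^{-1}Y$, $[X,Y]=\frac{q^H-q^{-H}}{q-q^{-1}}$, with coproduct $\Delta(q^{\pm H/2})=q^{\pm H/2}\otimes q^{\pm H/2}$, $\Delta(Z)=Z\otimes q^{H/2}+q^{-H/2}\otimes Z$ for $Z=X,Y$, and with $R$-matrix $$R=\sum_{n\ge 0}\frac{(q-q^{-1})^n}{[n]_q!}\,q^{-n(n+1)/2}\,q^{\frac12 H\otimes H+\frac n2(H\otimes 1-1\otimes H)}\,(X^n\otimes Y^n),\qquad R'=\sigma(R),$$ $\sigma$ being the flip of the tensor factors. For $J\in\frac12\mathbb N$ let $\rho^J$ be the spin-$J$ representation on $V^J$ with basis $(e_m)_{m=-J}^{J}$,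 $q^{H/2}e_m=q^me_m$, $Xe_m=\sqrt{[J-m]_q[J+m+1]_q}\,e_{m+1}$, $Ye_m=\sqrt{[J+m]_q[J-m+1]_q}\,e_{m-1}$; let $\mathrm{tr}_q^J(Z)=\mathrm{tr}(Z\rho^J(q^{-H}))$ be the quantum trace, $d_J=\mathrm{tr}_q^J(1)$, and $\kappa_J=q^{-J(J+1)}$. The quantum holonomy $M^J$ around a puncture is represented on $V^K$ by $D^K(M^J)=\kappa_J^{-1}(\rho^J\otimes\rho^K)(R'R)$, and its central element $c^J=\kappa_J\,\mathrm{tr}_q^J(M^J)$ by $D^K(c^J)=(\mathrm{tr}_q^J\otimes\mathrm{id})\big((\rho^J\otimes\rho^K)(R'R)\big)\in\mathrm{End}(V^K)$. The area spectrum $\mathrm{spec}^K(\hat a)$ on spin $K$ consists of the real $a$ with $\frac{|\Lambda|}{6}a\in[0,\pi]$ for which $\cos\big(\frac{|\Lambda|}{6}a\big)$ is in the spectrum of $\frac12D^K(c^{1/2})$. (1) For every $K\in\frac12\mathbb N$, $D^K(c^{1/2})=2\cos((2K+1)\theta)\,\mathrm{Id}$. If $[2K+1]_q\neq0$, then $d_K=[2K+1]_q$,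 $(\mathrm{tr}_q^{1/2}\otimes\mathrm{tr}_q^K)(R'R)=[2(2K+1)]_q$, and $D^K(c^{1/2})=\frac{[2(2K+1)]_q}{[2K+1]_q}\,\mathrm{Id}$. (2) The area spectrum is the single value $$\mathrm{spec}^K(\hat a)=\begin{cases}\frac{6}{|\Lambda|}(2K+1)\theta, & 0\le K<\frac12\left(\frac{\pi}{\theta}-1\right),\\[2pt] \frac{6}{|\Lambda|}\left[2\pi-(2K+1)\theta\right], & \frac12\left(\frac{\pi}{\theta}-1\right)\le K<\frac12\left(\frac{2\pi}{\theta}-1\right).\end{cases}$$ (3) If $q=e^{2\pi i/(k+2)}$ with $k\in\mathbb N$ and $K\le\frac k2$, then $$\mathrm{spec}^K(\hat a)=\begin{cases}\frac{6}{|\Lambda|}(2K+1)\frac{2\pi}{k+2}, & 0\le K<\frac k4,\\[2pt] \frac{6}{|\Lambda|}\left[2\pi-(2K+1)\frac{2\pi}{k+2}\right], & \frac k4\le K\le\frac k2.\end{cases}$$ For $k\ge1$ the same holds for the truncated algebra. That is, let $P$ be a projector of $V^{1/2}\otimes V^K$ onto its physical components: $P=1$ if $K+\frac12\le\frac k2$,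 and if $K=\frac k2$ then $P=EC$ for intertwiners $E:V^{K-1/2}\to V^{1/2}\otimes V^K$ and $C:V^{1/2}\otimes V^K\to V^{K-1/2}$ with $CE=1$. Such a $P$ exists, and for every such $P$, when $R'R$ is replaced by $R'R\,P$, one still has $D^K(c^{1/2})=2\cos((2K+1)\theta)\,\mathrm{Id}$ and $(\mathrm{tr}_q^{1/2}\otimes\mathrm{tr}_q^K)(R'R\,P)=[2(2K+1)]_q$ with $\theta=\frac{2\pi}{k+2}$, and the area spectrum is given by the same formula. -/

import Mathlib

open scoped Matrix Kronecker TensorProduct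

noncomputable section

/-! ### Powers of `q = exp (i θ)` and `q`-numbers -/

/-- `q ^ x = exp (i θ x)` for `q = exp (i θ)` and a real exponent `x`. -/
def qpow (θ x : ℝ) : ℂ := Complex.exp (Complex.I * ((θ * x : ℝ) : ℂ))

/-- The `q`-number `[x] = (q ^ x - q ^ (-x)) / (q - q⁻¹)`. -/
def qnum (θ x : ℝ) : ℂ := (qpow θ x - qpow θ (-x)) / (qpow θ 1 - qpow θ (-1))

/-- `[j]! = [1] [2] ⋯ [j]`. -/
def qfact (θ : ℝ) (j : ℕ) : ℂ := ∏ i ∈ Finset.range j, qnum θ ((i : ℝ) + 1)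

/-- A complex square root (principal branch). -/
def csqrt (z : ℂ) : ℂ := z ^ (1 / 2 : ℂ)

lemma csqrt_mul_self (z : ℂ) : csqrt z * csqrt z = z := by
  have h : csqrt z ^ 2 = z := by
    unfold csqrt
    simp
  rw [← sq, h]

lemma qpow_add (θ x y : ℝ) : qpow θ (x + y) = qpow θ x * qpow θ y := by
  unfold qpow
  rw [← Complex.exp_add]
  congr 1
  push_cast
  ring

lemma qpow_zero (θ : ℝ) : qpow θ 0 = 1 := by simp [qpow]

lemma qnum_zero (θ : ℝ) : qnum θ 0 = 0 := by simp [qnum]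

/-! ### The algebra `U_q(su(2))` -/

/-- Generators: `k = q ^ (H / 2)`, its inverse, `X` and `Y`. -/
inductive UqGen
  | k
  | kinv
  | X
  | Y

/-- The free generators. -/
abbrev ug (g : UqGen) : FreeAlgebra ℂ UqGen := FreeAlgebra.ι ℂ g

/-- Defining relations of `U_q(su(2))`. -/
inductive UqRel (θ : ℝ) : FreeAlgebra ℂ UqGen → FreeAlgebra ℂ UqGen → Prop
  | k_kinv : UqRel θ (ug .k * ug .kinv) 1
  | kinv_k : UqRel θ (ug .kinv * ug .k) 1
  | k_X : UqRel θ (ug .k * ug .X) (qpow θ 1 • (ug .X * ug .k))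
  | k_Y : UqRel θ (ug .k * ug .Y) (qpow θ (-1) • (ug .Y * ug .k))
  | X_Y : UqRel θ (ug .X * ug .Y - ug .Y * ug .X)
      ((qpow θ 1 - qpow θ (-1))⁻¹ • (ug .k * ug .k - ug .kinv * ug .kinv))

/-- `U_q(su(2))` at `q = exp (i θ)`, as an associative unital complex algebra. -/
abbrev Uq (θ : ℝ) : Type := RingQuot (UqRel θ)

/-- The generators of `U_q(su(2))`. -/
def uq (θ : ℝ) (g : UqGen) : Uq θ := RingQuot.mkAlgHom ℂ (UqRel θ) (ug g)

/-- The universal property: an algebra map is determined by images of the generators that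
satisfy the relations. -/
def Uq.lift (θ : ℝ) {A : Type} [Ring A] [Algebra ℂ A] (f : UqGen → A)
    (h1 : f .k * f .kinv = 1) (h2 : f .kinv * f .k = 1)
    (h3 : f .k * f .X = qpow θ 1 • (f .X * f .k))
    (h4 : f .k * f .Y = qpow θ (-1) • (f .Y * f .k))
    (h5 : f .X * f .Y - f .Y * f .X =
      (qpow θ 1 - qpow θ (-1))⁻¹ • (f .k * f .k - f .kinv * f .kinv)) : Uq θ →ₐ[ℂ] A :=
  RingQuot.liftAlgHom ℂ ⟨FreeAlgebra.lift ℂ f, by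
    intro x y h
    cases h <;> simpa using by assumption⟩

lemma Uq.lift_uq (θ : ℝ) {A : Type} [Ring A] [Algebra ℂ A] (f : UqGen → A)
    (h1 h2 h3 h4 h5) (g : UqGen) : Uq.lift θ f h1 h2 h3 h4 h5 (uq θ g) = f g := by
  simp [Uq.lift, uq, RingQuot.liftAlgHom_mkAlgHom_apply]

lemma uq_k_kinv (θ : ℝ) : uq θ .k * uq θ .kinv = 1 := by
  simpa [uq] using RingQuot.mkAlgHom_rel ℂ (UqRel.k_kinv (θ := θ))

lemma uq_kinv_k (θ : ℝ) : uq θ .kinv * uq θ .k = 1 := by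
  simpa [uq] using RingQuot.mkAlgHom_rel ℂ (UqRel.kinv_k (θ := θ))

lemma uq_k_X (θ : ℝ) : uq θ .k * uq θ .X = qpow θ 1 • (uq θ .X * uq θ .k) := by
  simpa [uq] using RingQuot.mkAlgHom_rel ℂ (UqRel.k_X (θ := θ))

lemma uq_k_Y (θ : ℝ) : uq θ .k * uq θ .Y = qpow θ (-1) • (uq θ .Y * uq θ .k) := by
  simpa [uq] using RingQuot.mkAlgHom_rel ℂ (UqRel.k_Y (θ := θ))

lemma uq_X_Y (θ : ℝ) : uq θ .X * uq θ .Y - uq θ .Y * uq θ .X =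
    (qpow θ 1 - qpow θ (-1))⁻¹ • (uq θ .k * uq θ .k - uq θ .kinv * uq θ .kinv) := by
  simpa [uq] using RingQuot.mkAlgHom_rel ℂ (UqRel.X_Y (θ := θ))

/-- Values of the coproduct on the generators. -/
def coprodGen (θ : ℝ) : UqGen → Uq θ ⊗[ℂ] Uq θ
  | .k => uq θ .k ⊗ₜ uq θ .k
  | .kinv => uq θ .kinv ⊗ₜ uq θ .kinv
  | .X => uq θ .X ⊗ₜ uq θ .k + uq θ .kinv ⊗ₜ uq θ .X
  | .Y => uq θ .Y ⊗ₜ uq θ .k + uq θ .kinv ⊗ₜ uq θ .Y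

lemma qpow_mul_neg (θ x : ℝ) : qpow θ x * qpow θ (-x) = 1 := by
  rw [← qpow_add, add_neg_cancel, qpow_zero]

lemma uq_kinv_X (θ : ℝ) : uq θ .kinv * uq θ .X = qpow θ (-1) • (uq θ .X * uq θ .kinv) := by
  have h : uq θ .kinv * (uq θ .k * uq θ .X) * uq θ .kinv = uq θ .X * uq θ .kinv := by
    rw [← mul_assoc, uq_kinv_k, one_mul]
  rw [← h, uq_k_X, mul_smul_comm, smul_mul_assoc, smul_smul, mul_comm (qpow θ (-1)),
    qpow_mul_neg, one_smul, mul_assoc, mul_assoc, uq_k_kinv, mul_one]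

lemma uq_kinv_Y (θ : ℝ) : uq θ .kinv * uq θ .Y = qpow θ 1 • (uq θ .Y * uq θ .kinv) := by
  have h : uq θ .kinv * (uq θ .k * uq θ .Y) * uq θ .kinv = uq θ .Y * uq θ .kinv := by
    rw [← mul_assoc, uq_kinv_k, one_mul]
  rw [← h, uq_k_Y, mul_smul_comm, smul_mul_assoc, smul_smul,
    qpow_mul_neg, one_smul, mul_assoc, mul_assoc, uq_k_kinv, mul_one]

lemma coprodGen_X_Y (θ : ℝ) :
    coprodGen θ .X * coprodGen θ .Y - coprodGen θ .Y * coprodGen θ .X =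
      (qpow θ 1 - qpow θ (-1))⁻¹ •
        (coprodGen θ .k * coprodGen θ .k - coprodGen θ .kinv * coprodGen θ .kinv) := by
  have hXY : uq θ .X * uq θ .Y = uq θ .Y * uq θ .X +
      (qpow θ 1 - qpow θ (-1))⁻¹ • (uq θ .k * uq θ .k - uq θ .kinv * uq θ .kinv) := by
    rw [← uq_X_Y]; abel
  simp only [coprodGen, mul_add, add_mul, Algebra.TensorProduct.tmul_mul_tmul, uq_k_X, uq_k_Y,
    uq_kinv_X, uq_kinv_Y, hXY, TensorProduct.add_tmul, TensorProduct.tmul_add,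
    TensorProduct.smul_tmul', TensorProduct.tmul_smul, TensorProduct.sub_tmul,
    TensorProduct.tmul_sub, smul_sub]
  abel

/-- The coproduct `Δ`. -/
def coprod (θ : ℝ) : Uq θ →ₐ[ℂ] Uq θ ⊗[ℂ] Uq θ :=
  Uq.lift θ (coprodGen θ)
    (by simp [coprodGen, uq_k_kinv]; rfl)
    (by simp [coprodGen, uq_kinv_k]; rfl)
    (by
      simp only [coprodGen, mul_add, add_mul, Algebra.TensorProduct.tmul_mul_tmul, uq_k_X,
        uq_k_kinv, uq_kinv_k, TensorProduct.smul_tmul', TensorProduct.tmul_smul, smul_add])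
    (by
      simp only [coprodGen, mul_add, add_mul, Algebra.TensorProduct.tmul_mul_tmul, uq_k_Y,
        uq_k_kinv, uq_kinv_k, TensorProduct.smul_tmul', TensorProduct.tmul_smul, smul_add])
    (coprodGen_X_Y θ)

/-! ### The spin-`n/2` representations. Spins are recorded by the natural number `n = 2 J`. -/

/-- The magnetic number `m = i - J ∈ {-J, …, J}` of the `i`-th basis vector, `J = n / 2`. -/
def wt (n : ℕ) (i : Fin (n + 1)) : ℝ := (i : ℝ) - n / 2

/-- Matrices of the generators in the basis `e_m` of `V^J`, `J = n / 2`: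
`q^{H/2} e_m = q^m e_m`, `X e_m = √([J-m][J+m+1]) e_{m+1}`, `Y e_m = √([J+m][J-m+1]) e_{m-1}`. -/
def rhoGen (θ : ℝ) (n : ℕ) : UqGen → Matrix (Fin (n + 1)) (Fin (n + 1)) ℂ
  | .k => Matrix.diagonal fun i => qpow θ (wt n i)
  | .kinv => Matrix.diagonal fun i => qpow θ (-wt n i)
  | .X => Matrix.of fun a b => if (a : ℕ) = b + 1 then
      csqrt (qnum θ (n / 2 - wt n b) * qnum θ (n / 2 + wt n b + 1)) else 0
  | .Y => Matrix.of fun a b => if (b : ℕ) = a + 1 then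
      csqrt (qnum θ (n / 2 + wt n b) * qnum θ (n / 2 - wt n b + 1)) else 0

lemma rhoGen_X_Y_apply (θ : ℝ) (n : ℕ) (a b : Fin (n + 1)) :
    (rhoGen θ n .X * rhoGen θ n .Y) a b =
      if a = b then qnum θ (n / 2 + wt n a) * qnum θ (n / 2 - wt n a + 1) else 0 := by
  rw [Matrix.mul_apply]
  by_cases ha : (a : ℕ) = 0
  · rw [Finset.sum_eq_zero]
    · have : (n / 2 + wt n a : ℝ) = 0 := by simp [wt, ha]
      simp [this, qnum_zero]
    · intro c _
      simp [rhoGen, ha]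
  · obtain ⟨c, hc⟩ : ∃ c : Fin (n + 1), (a : ℕ) = c + 1 := ⟨⟨a - 1, by omega⟩, by simp; omega⟩
    rw [Finset.sum_eq_single c]
    · by_cases hab : a = b
      · subst hab
        have h1 : (n / 2 - wt n c : ℝ) = n / 2 - wt n a + 1 := by simp [wt, hc]; ring
        have h2 : (n / 2 + wt n c + 1 : ℝ) = n / 2 + wt n a := by simp [wt, hc]
        simp only [rhoGen, Matrix.of_apply, hc, if_true, h1, h2]
        rw [mul_comm (qnum θ (n / 2 - wt n a + 1)), csqrt_mul_self]
      · have : ¬ ((b : ℕ) = c + 1) := fun h => hab (Fin.ext (by omega))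
        simp [rhoGen, this, hab]
    · intro d _ hd
      have : ¬ ((a : ℕ) = d + 1) := fun h => hd (Fin.ext (by omega))
      simp [rhoGen, this]
    · simp

lemma rhoGen_Y_X_apply (θ : ℝ) (n : ℕ) (a b : Fin (n + 1)) :
    (rhoGen θ n .Y * rhoGen θ n .X) a b =
      if a = b then qnum θ (n / 2 - wt n a) * qnum θ (n / 2 + wt n a + 1) else 0 := by
  rw [Matrix.mul_apply]
  by_cases ha : (a : ℕ) = n
  · rw [Finset.sum_eq_zero]
    · have : (n / 2 - wt n a : ℝ) = 0 := by simp [wt, ha]; ring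
      simp [this, qnum_zero]
    · intro c _
      have : ¬ ((c : ℕ) = a + 1) := by omega
      simp [rhoGen, this]
  · obtain ⟨c, hc⟩ : ∃ c : Fin (n + 1), (c : ℕ) = a + 1 := ⟨⟨a + 1, by omega⟩, rfl⟩
    rw [Finset.sum_eq_single c]
    · by_cases hab : a = b
      · subst hab
        have h1 : (n / 2 + wt n c : ℝ) = n / 2 + wt n a + 1 := by simp [wt, hc]
        have h2 : (n / 2 - wt n c + 1 : ℝ) = n / 2 - wt n a := by simp [wt, hc]; ring
        simp only [rhoGen, Matrix.of_apply, hc, if_true, h1, h2]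
        rw [mul_comm (qnum θ (n / 2 + wt n a + 1)), csqrt_mul_self]
      · have : ¬ ((c : ℕ) = b + 1) := fun h => hab (Fin.ext (by omega))
        simp [rhoGen, this, hab]
    · intro d _ hd
      have : ¬ ((d : ℕ) = a + 1) := fun h => hd (Fin.ext (by omega))
      simp [rhoGen, this]
    · simp

lemma qnum_identity (θ x m : ℝ) :
    qnum θ (x + m) * qnum θ (x - m + 1) - qnum θ (x - m) * qnum θ (x + m + 1) =
      (qpow θ 1 - qpow θ (-1))⁻¹ * (qpow θ m * qpow θ m - qpow θ (-m) * qpow θ (-m)) := by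
  have e : ∀ y, qpow θ (-y) = (qpow θ y)⁻¹ := fun y =>
    (eq_inv_of_mul_eq_one_right (qpow_mul_neg θ y))
  have hne : ∀ y, qpow θ y ≠ 0 := fun y => Complex.exp_ne_zero _
  by_cases hq : qpow θ 1 - qpow θ (-1) = 0
  · simp [qnum, hq]
  · unfold qnum
    rw [show -(x + m) = -x + -m by ring, show -(x - m + 1) = -x + m + -1 by ring,
      show -(x - m) = -x + m by ring, show -(x + m + 1) = -x + -m + -1 by ring,
      show x - m = x + -m by ring]
    simp only [qpow_add, e] at hq ⊢
    have h1 := hne 1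
    have h2 := hne x
    have h3 := hne m
    generalize qpow θ 1 = Q at *
    generalize qpow θ x = A at *
    generalize qpow θ m = B at *
    have h4 : Q ^ 2 - 1 ≠ 0 := by
      intro h
      apply hq
      field_simp
      simpa using h
    field_simp
    ring

/-- The representation `ρ^J` of `U_q(su(2))` on `V^J`, `J = n / 2`. -/
def rho (θ : ℝ) (n : ℕ) : Uq θ →ₐ[ℂ] Matrix (Fin (n + 1)) (Fin (n + 1)) ℂ :=
  Uq.lift θ (rhoGen θ n)
    (by simp [rhoGen, qpow_mul_neg])
    (by simp [rhoGen, mul_comm (qpow θ (-_)), qpow_mul_neg])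
    (by
      ext a b
      simp only [rhoGen, Matrix.diagonal_mul, Matrix.smul_apply, Matrix.mul_diagonal,
        Matrix.of_apply, smul_eq_mul]
      split_ifs with h
      · have : wt n a = 1 + wt n b := by simp [wt, h]; ring
        rw [this, qpow_add]; ring
      · simp)
    (by
      ext a b
      simp only [rhoGen, Matrix.diagonal_mul, Matrix.smul_apply, Matrix.mul_diagonal,
        Matrix.of_apply, smul_eq_mul]
      split_ifs with h
      · have : wt n a = -1 + wt n b := by simp [wt, h]; ring
        rw [this, qpow_add]; ring
      · simp)
    (by
      ext a b
      rw [Matrix.sub_apply, rhoGen_X_Y_apply, rhoGen_Y_X_apply]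
      by_cases h : a = b
      · subst h
        simp [rhoGen, qnum_identity]
      · simp [rhoGen, h])

/-- `ρ^I ⊗ ρ^J` on `U_q ⊗ U_q`, with values in `End (V^I ⊗ V^J)`; `I = a / 2`, `J = b / 2`. -/
def rhoTensor (θ : ℝ) (a b : ℕ) : Uq θ ⊗[ℂ] Uq θ →ₐ[ℂ]
    Matrix (Fin (a + 1) × Fin (b + 1)) (Fin (a + 1) × Fin (b + 1)) ℂ :=
  (Matrix.kroneckerAlgEquiv (Fin (a + 1)) (Fin (b + 1)) ℂ).toAlgHom.comp
    (Algebra.TensorProduct.map (rho θ a) (rho θ b))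

/-- The tensor product representation `ρ^I ⊠ ρ^J = (ρ^I ⊗ ρ^J) ∘ Δ`. -/
def rhoBox (θ : ℝ) (a b : ℕ) : Uq θ →ₐ[ℂ]
    Matrix (Fin (a + 1) × Fin (b + 1)) (Fin (a + 1) × Fin (b + 1)) ℂ :=
  (rhoTensor θ a b).comp (coprod θ)

/-! ### The `R`-matrix and the quantum trace -/

/-- `R^{IJ} = (ρ^I ⊗ ρ^J)(R)` for
`R = ∑ⱼ (q - q⁻¹)^j / [j]! · q^{-j(j+1)/2} · q^{(H ⊗ H)/2 + (j/2)(H ⊗ 1 - 1 ⊗ H)} (X^j ⊗ Y^j)`.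
On `e_m ⊗ e_{m'}` the operator `H ⊗ 1` is `2 m` and `1 ⊗ H` is `2 m'`; the terms with `j > 2 I`
vanish because `ρ^I(X)^(2 I + 1) = 0`. -/
def Rmat (θ : ℝ) (a b : ℕ) :
    Matrix (Fin (a + 1) × Fin (b + 1)) (Fin (a + 1) × Fin (b + 1)) ℂ :=
  ∑ j ∈ Finset.range (a + 1),
    ((qpow θ 1 - qpow θ (-1)) ^ j / qfact θ j * qpow θ (-((j : ℝ) * (j + 1) / 2))) •
      (Matrix.diagonal (fun p : Fin (a + 1) × Fin (b + 1) =>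
          qpow θ (2 * wt a p.1 * wt b p.2 + j * (wt a p.1 - wt b p.2))) *
        ((rho θ a (uq θ .X) ^ j) ⊗ₖ (rho θ b (uq θ .Y) ^ j)))

/-- `(R')^{IJ} = (ρ^I ⊗ ρ^J)(σ(R))`, where `σ` flips the two tensor factors. -/
def RmatFlip (θ : ℝ) (a b : ℕ) :
    Matrix (Fin (a + 1) × Fin (b + 1)) (Fin (a + 1) × Fin (b + 1)) ℂ :=
  (Rmat θ b a).submatrix Prod.swap Prod.swap

/-- The monodromy `(R'R)^{IJ}`. -/
def RR (θ : ℝ) (a b : ℕ) :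
    Matrix (Fin (a + 1) × Fin (b + 1)) (Fin (a + 1) × Fin (b + 1)) ℂ :=
  RmatFlip θ a b * Rmat θ a b

/-- The group-like element `g = q^{-H}` that defines the quantum trace. -/
def grouplike (θ : ℝ) : Uq θ := uq θ .kinv * uq θ .kinv

/-- The quantum trace `tr_q^J(Z) = tr(Z ρ^J(g))` on `End (V^J)`. -/
def qtr (θ : ℝ) (n : ℕ) (Z : Matrix (Fin (n + 1)) (Fin (n + 1)) ℂ) : ℂ :=
  (Z * rho θ n (grouplike θ)).trace

/-- The quantum dimension `d_J = tr_q^J(1)`. -/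
def qdim (θ : ℝ) (n : ℕ) : ℂ := qtr θ n 1

/-- The partial quantum trace `tr_q^I ⊗ id : End (V^I ⊗ V^J) → End (V^J)`. -/
def qtrLeft (θ : ℝ) (a b : ℕ)
    (Z : Matrix (Fin (a + 1) × Fin (b + 1)) (Fin (a + 1) × Fin (b + 1)) ℂ) :
    Matrix (Fin (b + 1)) (Fin (b + 1)) ℂ :=
  Matrix.of fun c d => qtr θ a (Matrix.of fun i j => Z (i, c) (j, d))

/-! ### The quantum holonomy, its central element, and the area spectrum -/

/-- `κ_J = q^{-J(J+1)}`, `J = n / 2`. -/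
def kap (θ : ℝ) (n : ℕ) : ℂ := qpow θ (-((n / 2 : ℝ) * (n / 2 + 1)))

/-- The representation `D^K(M^J) = κ_J⁻¹ (R'R)^{JK} ∈ End (V^J) ⊗ End (V^K)` of the quantum
holonomy `M^J` around a puncture; `J = a / 2`, `K = n / 2`. -/
def holonomyRep (θ : ℝ) (a n : ℕ) :
    Matrix (Fin (a + 1) × Fin (n + 1)) (Fin (a + 1) × Fin (n + 1)) ℂ :=
  (kap θ a)⁻¹ • RR θ a n

/-- `D^K(c^J)` for the central element `c^J = κ_J tr_q^J(M^J)`, an operator on `V^K`. -/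
def centralRep (θ : ℝ) (a n : ℕ) : Matrix (Fin (n + 1)) (Fin (n + 1)) ℂ :=
  kap θ a • qtrLeft θ a n (holonomyRep θ a n)

/-- `s_{JK} = (tr_q^J ⊗ tr_q^K)(R'R)`. -/
def sMat (θ : ℝ) (a n : ℕ) : ℂ := qtr θ n (qtrLeft θ a n (RR θ a n))

/-- The area spectrum attached to the operator `D = D^K(c^{1/2})`: the numbers `x` with
`|Λ| x / 6 ∈ [0, π]` for which `cos(|Λ| x / 6)` is in the spectrum of `D / 2`. -/
def areaSpec (Λ : ℝ) {n : ℕ} (D : Matrix (Fin (n + 1)) (Fin (n + 1)) ℂ) : Set ℝ :=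
  {x | |Λ| / 6 * x ∈ Set.Icc 0 Real.pi ∧
    ((Real.cos (|Λ| / 6 * x) : ℝ) : ℂ) ∈ spectrum ℂ ((1 / 2 : ℂ) • D)}

/-! ### Truncation at `q = exp (2 π i / (k + 2))` -/

/-- The (doubled) spins `c = 2 L` of the physical components of `V^I ⊗ V^J`, `a = 2 I`, `b = 2 J`:
`|I - J| ≤ L ≤ min (I + J) (k - I - J)` and `I + J + L` is an integer. -/
def admissible (k a b : ℕ) : Finset ℕ :=
  (Finset.range (a + b + 1)).filter fun c =>
    a ≤ b + c ∧ b ≤ a + c ∧ a + b + c ≤ 2 * k ∧ Even (a + b + c)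

/-- `P` is the projector of `V^I ⊗ V^J` onto its physical components. If `I + J ≤ k / 2`, no
component is cut off and `P = 1`. Otherwise the physical components are given by intertwiners
`E_L : V^L → V^I ⊗ V^J` and `C_L : V^I ⊗ V^J → V^L` with `C_L E_{L'} = δ_{L L'}`, and
`P = ∑_L E_L C_L`. -/
def IsTruncation (θ : ℝ) (k a b : ℕ)
    (P : Matrix (Fin (a + 1) × Fin (b + 1)) (Fin (a + 1) × Fin (b + 1)) ℂ) : Prop :=
  (a + b ≤ k ∧ P = 1) ∨
  (k < a + b ∧
    ∃ (E : (c : ℕ) → Matrix (Fin (a + 1) × Fin (b + 1)) (Fin (c + 1)) ℂ)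
      (C : (c : ℕ) → Matrix (Fin (c + 1)) (Fin (a + 1) × Fin (b + 1)) ℂ),
      (∀ c ∈ admissible k a b, ∀ ξ : Uq θ,
        rhoBox θ a b ξ * E c = E c * rho θ c ξ ∧ C c * rhoBox θ a b ξ = rho θ c ξ * C c) ∧
      (∀ c ∈ admissible k a b, C c * E c = 1) ∧
      (∀ c ∈ admissible k a b, ∀ d ∈ admissible k a b, c ≠ d → C c * E d = 0) ∧
      P = ∑ c ∈ admissible k a b, E c * C c)

/-- `D^K(M^J)` for the truncated algebra: `R'R` is cut down by the projector `P` onto the physical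
components of `V^J ⊗ V^K`. -/
def holonomyRepTrunc (θ : ℝ) (a n : ℕ)
    (P : Matrix (Fin (a + 1) × Fin (n + 1)) (Fin (a + 1) × Fin (n + 1)) ℂ) :
    Matrix (Fin (a + 1) × Fin (n + 1)) (Fin (a + 1) × Fin (n + 1)) ℂ :=
  (kap θ a)⁻¹ • (RR θ a n * P)

/-- `D^K(c^J)` for the truncated algebra. -/
def centralRepTrunc (θ : ℝ) (a n : ℕ)
    (P : Matrix (Fin (a + 1) × Fin (n + 1)) (Fin (a + 1) × Fin (n + 1)) ℂ) :
    Matrix (Fin (n + 1)) (Fin (n + 1)) ℂ :=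
  kap θ a • qtrLeft θ a n (holonomyRepTrunc θ a n P)

/-- `(tr_q^J ⊗ tr_q^K)(R'R P)`. -/
def sMatTrunc (θ : ℝ) (a n : ℕ)
    (P : Matrix (Fin (a + 1) × Fin (n + 1)) (Fin (a + 1) × Fin (n + 1)) ℂ) : ℂ :=
  qtr θ n (qtrLeft θ a n (RR θ a n * P))

end

/-!
With its first tensor factor in spin `1/2`, the monodromy `R'R` is a `2 × 2` matrix over
`U_q(su(2))`, the product of two triangular matrices. Its quantum trace is the Casimir element
`(q - q⁻¹)² Y X + q q^H + q⁻¹ q^{-H}`, which acts on `V^K` by `q^{2K+1} + q^{-(2K+1)}`.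

The monodromy satisfies a quadratic equation of Cayley–Hamilton type. If `q^{k+2} = 1` and
`K = k / 2`, its eigenvalue `1` occurs on the image of `V^{K - 1/2}` in `V^{1/2} ⊗ V^K`, so that the
projector `P` onto that image is a linear function of `R'R`. Hence `R'R P` has a partial quantum
trace that is explicitly computable, and it turns out to be the same as that of `R'R`. Such a
projector exists because the Clebsch–Gordan map `E` from `V^{K - 1/2}` satisfies
`Eᵀ E = q⁻¹ [2K + 1]`, which is nonzero.
-/

noncomputable section

/-! ### `q`-numbers -/

lemma qpow_ne_zero (θ x : ℝ) : qpow θ x ≠ 0 := Complex.exp_ne_zero _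

lemma qpow_neg (θ x : ℝ) : qpow θ (-x) = (qpow θ x)⁻¹ :=
  eq_inv_of_mul_eq_one_right (qpow_mul_neg θ x)

lemma qpow_add_qpow_neg (θ x : ℝ) :
    qpow θ x + qpow θ (-x) = ((2 * Real.cos (x * θ) : ℝ) : ℂ) := by
  push_cast
  rw [Complex.two_cos]
  unfold qpow
  congr 2 <;> push_cast <;> ring

/-- The denominator `q - q⁻¹` of the `q`-numbers. -/
def qdiff (θ : ℝ) : ℂ := qpow θ 1 - qpow θ (-1)

lemma qdiff_mul_qnum {θ : ℝ} (h : qdiff θ ≠ 0) (x : ℝ) :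
    qdiff θ * qnum θ x = qpow θ x - qpow θ (-x) :=
  mul_div_cancel₀ _ h

lemma qnum_one {θ : ℝ} (h : qdiff θ ≠ 0) : qnum θ 1 = 1 := div_self h

lemma qdiff_ne_zero_of_qnum_ne_zero {θ x : ℝ} (h : qnum θ x ≠ 0) : qdiff θ ≠ 0 :=
  (div_ne_zero_iff.mp h).2

lemma qnum_two_mul (θ x : ℝ) :
    qnum θ (2 * x) = (qpow θ x + qpow θ (-x)) * qnum θ x := by
  rw [qnum, qnum, two_mul, neg_add, qpow_add, qpow_add]
  ring

lemma qpow_two_mul_nat_of_qdiff_eq_zero {θ : ℝ} (h : qdiff θ = 0) (j : ℕ) :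
    qpow θ (2 * j) = 1 := by
  have qpow_two : qpow θ 2 = 1 := by
    rw [← one_add_one_eq_two, qpow_add, ← qpow_mul_neg θ 1, ← sub_eq_zero.mp h]
  induction j with
  | zero => simp [qpow_zero]
  | succ j ih => rw [Nat.cast_succ, mul_add_one, qpow_add, ih, qpow_two, one_mul]

/- At `q = ±1` the left-hand side is `0` because of the junk value of `qnum`; the right-hand side
then vanishes only because `j` is an integer. -/
lemma qdiff_sq_mul_qnum_mul_qnum_nat (θ x : ℝ) (j : ℕ) :
    qdiff θ ^ 2 * (qnum θ x * qnum θ j) =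
      qpow θ (x + j) + qpow θ (-(x + j)) - (qpow θ (x - j) + qpow θ (-(x - j))) := by
  by_cases h : qdiff θ = 0
  · rw [show x + j = (x - j) + 2 * j by ring, neg_add, qpow_add, qpow_add,
      qpow_neg _ (2 * (j : ℝ)), qpow_two_mul_nat_of_qdiff_eq_zero h, h]
    simp
  · calc qdiff θ ^ 2 * (qnum θ x * qnum θ j)
        = (qdiff θ * qnum θ x) * (qdiff θ * qnum θ j) := by ring
      _ = _ := by
        rw [qdiff_mul_qnum h, qdiff_mul_qnum h, neg_add, neg_sub', sub_neg_eq_add,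
          sub_eq_add_neg x]
        simp only [qpow_add]
        ring

/-! ### The Casimir element -/

/-- The quadratic Casimir element `(q - q⁻¹)² Y X + q q^H + q⁻¹ q^{-H}` of `U_q(su(2))`. -/
def casimir (θ : ℝ) : Uq θ :=
  qdiff θ ^ 2 • (uq θ .Y * uq θ .X) + qpow θ 1 • uq θ .k ^ 2 + qpow θ (-1) • uq θ .kinv ^ 2

lemma casimir_eq_X_mul_Y (θ : ℝ) :
    casimir θ =
      qdiff θ ^ 2 • (uq θ .X * uq θ .Y) + qpow θ (-1) • uq θ .k ^ 2 +
        qpow θ 1 • uq θ .kinv ^ 2 := by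
  have h : qdiff θ ^ 2 * (qdiff θ)⁻¹ = qdiff θ := by
    rw [sq]; exact mul_self_mul_inv _
  have hXY : uq θ .Y * uq θ .X =
      uq θ .X * uq θ .Y - (qdiff θ)⁻¹ • (uq θ .k ^ 2 - uq θ .kinv ^ 2) := by
    rw [sq, sq, qdiff, ← uq_X_Y, sub_sub_cancel]
  rw [casimir, hXY, smul_sub, smul_smul, h, qdiff]
  module

/-- The scalar `q^{2K+1} + q^{-(2K+1)}` by which the Casimir element acts on `V^K`, `K = n / 2`. -/
def casVal (θ : ℝ) (n : ℕ) : ℂ := qpow θ ((n : ℝ) + 1) + qpow θ (-((n : ℝ) + 1))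

lemma rho_uq (θ : ℝ) (n : ℕ) (g : UqGen) : rho θ n (uq θ g) = rhoGen θ n g :=
  Uq.lift_uq ..

lemma rho_casimir (θ : ℝ) (n : ℕ) : rho θ n (casimir θ) = casVal θ n • 1 := by
  simp only [casimir, map_add, map_smul, map_mul, map_pow, rho_uq]
  ext a b
  simp only [Matrix.add_apply, Matrix.smul_apply, rhoGen_Y_X_apply, smul_eq_mul]
  rcases eq_or_ne a b with rfl | hab
  · have h : (n / 2 + wt n a + 1 : ℝ) = (((a : ℕ) + 1 : ℕ) : ℝ) := by simp [wt]
    simp only [rhoGen, sq (Matrix.diagonal _), Matrix.diagonal_mul_diagonal,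
      Matrix.diagonal_apply_eq, if_true, Matrix.one_apply_eq, casVal, h,
      qdiff_sq_mul_qnum_mul_qnum_nat, ← qpow_add]
    simp only [wt]
    push_cast
    ring_nf
  · simp [rhoGen, Matrix.diagonal_pow, hab]

/-! ### The monodromy in spin `1/2` -/

/-- The coefficient of `e_{m+1}` in `X e_m`, equal to that of `e_m` in `Y e_{m+1}`, where
`m = i - n / 2`. -/
def ladder (θ : ℝ) (n i : ℕ) : ℂ := csqrt (qnum θ ((n : ℝ) - i) * qnum θ ((i : ℝ) + 1))

lemma ladder_mul_self (θ : ℝ) (n i : ℕ) :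
    ladder θ n i * ladder θ n i = qnum θ ((n : ℝ) - i) * qnum θ ((i : ℝ) + 1) :=
  csqrt_mul_self _

lemma rhoGen_X_apply (θ : ℝ) (n : ℕ) (a b : Fin (n + 1)) :
    rhoGen θ n .X a b = if (a : ℕ) = b + 1 then ladder θ n b else 0 := by
  simp only [rhoGen, Matrix.of_apply, ladder, wt]
  congr 4 <;> ring

lemma rhoGen_X_transpose (θ : ℝ) (n : ℕ) : (rhoGen θ n .X)ᵀ = rhoGen θ n .Y := by
  ext a b
  rw [Matrix.transpose_apply, rhoGen_X_apply]
  simp only [rhoGen, Matrix.of_apply, ladder, wt]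
  split_ifs with h
  · rw [mul_comm, h]
    push_cast
    congr 3 <;> ring
  · rfl

lemma rhoGen_Y_apply (θ : ℝ) (n : ℕ) (a b : Fin (n + 1)) :
    rhoGen θ n .Y a b = if (b : ℕ) = a + 1 then ladder θ n a else 0 := by
  rw [← rhoGen_X_transpose, Matrix.transpose_apply, rhoGen_X_apply]

lemma ladder_one_zero {θ : ℝ} (h : qdiff θ ≠ 0) : ladder θ 1 0 = 1 := by
  simp [ladder, qnum_one h, csqrt]

lemma wt_one_zero : wt 1 0 = -(1 / 2) := by norm_num [wt]

lemma wt_one_one : wt 1 1 = 1 / 2 := by norm_num [wt]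

/-- Evaluation of a `2 × 2` matrix over `U_q(su(2))` as an operator on `V^{1/2} ⊗ V^K`, `K = n / 2`:
the matrix units act on `V^{1/2}` and the entries act on `V^K`. -/
def halfSpinEval (θ : ℝ) (n : ℕ) : Matrix (Fin 2) (Fin 2) (Uq θ) →ₐ[ℂ]
    Matrix (Fin (1 + 1) × Fin (n + 1)) (Fin (1 + 1) × Fin (n + 1)) ℂ :=
  (Matrix.compAlgEquiv (Fin 2) (Fin (n + 1)) ℂ ℂ).toAlgHom.comp (rho θ n).mapMatrix

lemma halfSpinEval_apply (θ : ℝ) (n : ℕ) (M : Matrix (Fin 2) (Fin 2) (Uq θ))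
    (p r : Fin (1 + 1) × Fin (n + 1)) :
    halfSpinEval θ n M p r = rho θ n (M p.1 r.1) p.2 r.2 := rfl

/-- The off-diagonal coefficient `q^{-1/2} (q - q⁻¹)` of the `R`-matrix in spin `1/2`. -/
def offCoeff (θ : ℝ) : ℂ := qdiff θ * qpow θ (-(1 / 2))

lemma offCoeff_mul_self (θ : ℝ) : offCoeff θ * offCoeff θ = qdiff θ ^ 2 * qpow θ (-1) := by
  rw [offCoeff, mul_mul_mul_comm, ← sq, ← qpow_add]
  norm_num

lemma rhoGen_one_X_sq (θ : ℝ) : rhoGen θ 1 .X ^ 2 = 0 := by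
  ext a b
  rw [sq, Matrix.mul_apply, Fin.sum_univ_two]
  simp only [rhoGen_X_apply]
  fin_cases a <;> fin_cases b <;> simp

lemma rhoGen_one_Y_sq (θ : ℝ) : rhoGen θ 1 .Y ^ 2 = 0 := by
  rw [← rhoGen_X_transpose, ← Matrix.transpose_pow, rhoGen_one_X_sq, Matrix.transpose_zero]

lemma Rmat_eq_of_sq_kronecker_sq_eq_zero {θ : ℝ} {a b : ℕ}
    (h : (rhoGen θ a .X ^ 2) ⊗ₖ (rhoGen θ b .Y ^ 2) = 0) :
    Rmat θ a b =
      Matrix.diagonal (fun p => qpow θ (2 * wt a p.1 * wt b p.2)) +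
      (qdiff θ * qpow θ (-1)) •
        (Matrix.diagonal (fun p => qpow θ (2 * wt a p.1 * wt b p.2 + (wt a p.1 - wt b p.2))) *
          (rhoGen θ a .X ⊗ₖ rhoGen θ b .Y)) := by
  have kronecker_eq_zero {j : ℕ} (hj : 2 ≤ j) :
      (rhoGen θ a .X ^ j) ⊗ₖ (rhoGen θ b .Y ^ j) = 0 := by
    obtain ⟨i, rfl⟩ := Nat.exists_eq_add_of_le hj
    rw [pow_add, pow_add, Matrix.mul_kronecker_mul, h, Matrix.zero_mul]
  have qdiff_div : qdiff θ / qfact θ 1 = qdiff θ := by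
    by_cases hq : qdiff θ = 0 <;> simp [qfact, qnum_one, hq]
  rw [Rmat, Finset.sum_range_succ']
  refine (add_comm _ _).trans ?_
  congr 1
  · simp [qfact, qpow_zero]
  · cases a with
    | zero =>
      have X_eq_zero : rhoGen θ 0 .X = 0 := by
        ext i j
        rw [rhoGen_X_apply, if_neg (by omega), Matrix.zero_apply]
      simp [X_eq_zero]
    | succ a =>
      rw [Finset.sum_range_succ', Finset.sum_eq_zero, zero_add, ← qdiff]
      · simp [qdiff_div, rho_uq]
      · intro j _
        rw [rho_uq, rho_uq, kronecker_eq_zero (by omega), Matrix.mul_zero, smul_zero]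

lemma qdiff_mul_qpow_mul_ladder_one (θ : ℝ) :
    qdiff θ * qpow θ (-1) * (qpow θ (1 / 2) * ladder θ 1 0) = offCoeff θ := by
  rw [offCoeff, show (-(1 / 2) : ℝ) = -1 + 1 / 2 by norm_num, qpow_add]
  by_cases h : qdiff θ = 0
  · simp [h]
  · rw [ladder_one_zero h]; ring

lemma Rmat_one_left (θ : ℝ) (n : ℕ) :
    Rmat θ 1 n = halfSpinEval θ n !![uq θ .kinv, 0; offCoeff θ • uq θ .Y, uq θ .k] := by
  rw [Rmat_eq_of_sq_kronecker_sq_eq_zero (by rw [rhoGen_one_X_sq, Matrix.zero_kronecker]),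
    ← qdiff_mul_qpow_mul_ladder_one]
  ext ⟨s, i⟩ ⟨t, j⟩
  simp only [Matrix.add_apply, Matrix.smul_apply, Matrix.diagonal_mul, Matrix.diagonal_apply,
    Matrix.kronecker_apply, rhoGen_X_apply, halfSpinEval_apply, Prod.mk.injEq, smul_eq_mul]
  fin_cases s <;> fin_cases t
  · simp [wt_one_zero, rho_uq, rhoGen, Matrix.diagonal_apply]
  · simp
  · simp [wt_one_one, rho_uq]
    ring
  · simp [wt_one_one, rho_uq, rhoGen, Matrix.diagonal_apply]

lemma RmatFlip_one_left (θ : ℝ) (n : ℕ) :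
    RmatFlip θ 1 n = halfSpinEval θ n !![uq θ .kinv, offCoeff θ • uq θ .X; 0, uq θ .k] := by
  have two_mul_mul_inv (x : ℝ) : 2 * x * 2⁻¹ = x := by ring
  rw [RmatFlip,
    Rmat_eq_of_sq_kronecker_sq_eq_zero (by rw [rhoGen_one_Y_sq, Matrix.kronecker_zero]),
    ← qdiff_mul_qpow_mul_ladder_one]
  ext ⟨s, i⟩ ⟨t, j⟩
  simp only [Matrix.submatrix_apply, Prod.swap_prod_mk, Matrix.add_apply, Matrix.smul_apply,
    Matrix.diagonal_mul, Matrix.diagonal_apply, Matrix.kronecker_apply, rhoGen_Y_apply,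
    halfSpinEval_apply, Prod.mk.injEq, smul_eq_mul]
  fin_cases s <;> fin_cases t
  · simp [wt_one_zero, rho_uq, rhoGen, Matrix.diagonal_apply, two_mul_mul_inv]
  · simp [wt_one_zero, rho_uq]
    ring_nf
  · simp
  · simp [wt_one_one, rho_uq, rhoGen, Matrix.diagonal_apply, two_mul_mul_inv]

/-- The universal form of the monodromy `R'R` when its first tensor factor acts in spin `1/2`, as a
`2 × 2` matrix over `U_q(su(2))`. -/
def monodromy (θ : ℝ) : Matrix (Fin 2) (Fin 2) (Uq θ) :=
  !![uq θ .kinv, offCoeff θ • uq θ .X; 0, uq θ .k] *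
    !![uq θ .kinv, 0; offCoeff θ • uq θ .Y, uq θ .k]

lemma RR_one_left (θ : ℝ) (n : ℕ) : RR θ 1 n = halfSpinEval θ n (monodromy θ) := by
  rw [RR, RmatFlip_one_left, Rmat_one_left, monodromy, map_mul]

lemma monodromy_eq (θ : ℝ) :
    monodromy θ =
      !![qpow θ (-1) • casimir θ - qpow θ (-2) • uq θ .k ^ 2, offCoeff θ • (uq θ .X * uq θ .k);
        offCoeff θ • (uq θ .k * uq θ .Y), uq θ .k ^ 2] := by
  have hq : qpow θ (-1) * qpow θ (-1) = qpow θ (-2) := by rw [← qpow_add]; norm_num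
  have hq' : qpow θ (-1) * qpow θ 1 = 1 := by rw [mul_comm, qpow_mul_neg]
  rw [monodromy, Matrix.mul_fin_two, casimir_eq_X_mul_Y]
  simp only [smul_mul_assoc, mul_smul_comm, offCoeff_mul_self, smul_add, smul_smul, hq, hq',
    one_smul, zero_mul, zero_add, mul_zero, sq]
  congr 3
  module

lemma monodromy_quantum_trace (θ : ℝ) :
    qpow θ 1 • monodromy θ 0 0 + qpow θ (-1) • monodromy θ 1 1 = casimir θ := by
  have hq : qpow θ 1 * qpow θ (-2) = qpow θ (-1) := by rw [← qpow_add]; norm_num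
  simp [monodromy_eq, smul_sub, smul_smul, qpow_mul_neg, hq]

lemma exists_monodromy_inverse (θ : ℝ) : ∃ N : Matrix (Fin 2) (Fin 2) (Uq θ),
    N * monodromy θ = 1 ∧
      monodromy θ + qpow θ (-2) • N = Matrix.diagonal fun _ => qpow θ (-1) • casimir θ := by
  have q_ne_zero := qpow_ne_zero θ 1
  have qpow_neg_two : qpow θ (-2) = (qpow θ 1)⁻¹ ^ 2 := by
    rw [← qpow_neg, sq, ← qpow_add]; norm_num
  have offCoeff_sq : offCoeff θ ^ 2 = qdiff θ ^ 2 * (qpow θ 1)⁻¹ := by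
    rw [sq, offCoeff_mul_self, qpow_neg]
  have hX : !![uq θ .k, (-(qpow θ 1 * offCoeff θ)) • uq θ .X; 0, uq θ .kinv] *
      !![uq θ .kinv, offCoeff θ • uq θ .X; 0, uq θ .k] = 1 := by
    have off_diagonal : offCoeff θ • qpow θ 1 • (uq θ .X * uq θ .k) +
        (-(qpow θ 1 * offCoeff θ)) • (uq θ .X * uq θ .k) = 0 := by module
    rw [Matrix.mul_fin_two, Matrix.one_fin_two]
    simp only [mul_zero, zero_mul, mul_smul_comm, smul_mul_assoc, uq_k_X,
      uq_k_kinv, uq_kinv_k, off_diagonal, smul_zero, zero_add, add_zero]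
  have hY : !![uq θ .k, 0; (-(qpow θ 1 * offCoeff θ)) • uq θ .Y, uq θ .kinv] *
      !![uq θ .kinv, 0; offCoeff θ • uq θ .Y, uq θ .k] = 1 := by
    have off_diagonal : (-(qpow θ 1 * offCoeff θ)) • (uq θ .Y * uq θ .kinv) +
        offCoeff θ • qpow θ 1 • (uq θ .Y * uq θ .kinv) = 0 := by module
    rw [Matrix.mul_fin_two, Matrix.one_fin_two]
    simp only [mul_zero, zero_mul, mul_smul_comm, smul_mul_assoc, uq_kinv_Y,
      uq_k_kinv, uq_kinv_k, off_diagonal, smul_zero, zero_add, add_zero]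
  refine ⟨!![uq θ .k, 0; (-(qpow θ 1 * offCoeff θ)) • uq θ .Y, uq θ .kinv] *
    !![uq θ .k, (-(qpow θ 1 * offCoeff θ)) • uq θ .X; 0, uq θ .kinv], ?_, ?_⟩
  · rw [monodromy, mul_assoc, ← mul_assoc _ !![uq θ .kinv, _; _, _], hX, one_mul, hY]
  · rw [monodromy_eq, Matrix.mul_fin_two, Matrix.diagonal_fin_two, ← Matrix.ext_iff]
    simp only [Fin.forall_fin_two, Matrix.add_apply, Matrix.smul_apply, Matrix.of_apply,
      Matrix.cons_val, zero_mul, mul_zero, add_zero, mul_smul_comm, smul_mul_assoc, smul_smul,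
      uq_k_X, uq_k_Y, sq (uq θ _), qpow_neg_two, qpow_neg]
    refine ⟨⟨sub_add_cancel _ _, ?_⟩, ?_, ?_⟩
    · match_scalars
      field_simp
      ring
    · match_scalars
      field_simp
      ring
    · simp only [casimir, sq (uq θ _)]
      match_scalars <;> field_simp
      · rw [offCoeff_sq]
        field_simp
      · exact (qpow_mul_neg θ 1).symm

lemma monodromy_cayley_hamilton (θ : ℝ) :
    monodromy θ ^ 2 =
      Matrix.diagonal (fun _ => qpow θ (-1) • casimir θ) * monodromy θ - qpow θ (-2) • 1 := by
  obtain ⟨N, hN, hMN⟩ := exists_monodromy_inverse θ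
  rw [← hMN, add_mul, smul_mul_assoc, hN, add_sub_cancel_right, sq]

lemma qtrLeft_halfSpinEval (θ : ℝ) (n : ℕ) (M : Matrix (Fin 2) (Fin 2) (Uq θ)) :
    qtrLeft θ 1 n (halfSpinEval θ n M) =
      rho θ n (qpow θ 1 • M 0 0 + qpow θ (-1) • M 1 1) := by
  ext i j
  simp only [qtrLeft, qtr, grouplike, map_mul, rho_uq, rhoGen, Matrix.diagonal_mul_diagonal,
    ← qpow_add, Matrix.of_apply, halfSpinEval_apply]
  rw [Matrix.trace_fin_two]
  simp [Matrix.mul_diagonal, wt_one_zero, wt_one_one, mul_comm]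
  norm_num

lemma trace_halfSpinEval (θ : ℝ) (n : ℕ) (M : Matrix (Fin 2) (Fin 2) (Uq θ)) :
    (halfSpinEval θ n M).trace = (rho θ n M.trace).trace := by
  simp [Matrix.trace, Fintype.sum_prod_type, halfSpinEval_apply, Finset.sum_add_distrib]

lemma qtrLeft_RR_one_left (θ : ℝ) (n : ℕ) : qtrLeft θ 1 n (RR θ 1 n) = casVal θ n • 1 := by
  rw [RR_one_left, qtrLeft_halfSpinEval, monodromy_quantum_trace, rho_casimir]

lemma halfSpinEval_diagonal_casimir (θ : ℝ) (n : ℕ) :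
    halfSpinEval θ n (Matrix.diagonal fun _ => qpow θ (-1) • casimir θ) =
      (qpow θ (-1) * casVal θ n) • 1 := by
  ext ⟨s, i⟩ ⟨t, j⟩
  rw [halfSpinEval_apply]
  fin_cases s <;> fin_cases t <;> simp [rho_casimir, Matrix.one_apply]

lemma RR_one_left_sq (θ : ℝ) (n : ℕ) :
    RR θ 1 n ^ 2 = (qpow θ (-1) * casVal θ n) • RR θ 1 n - qpow θ (-2) • 1 := by
  rw [RR_one_left, ← map_pow, monodromy_cayley_hamilton, map_sub, map_mul,
    halfSpinEval_diagonal_casimir, map_smul, map_one,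
    smul_mul_assoc, one_mul]

lemma qdiff_mul_sum_qpow_wt (θ : ℝ) (n : ℕ) :
    qdiff θ * ∑ i, qpow θ (2 * wt n i) = qpow θ ((n : ℝ) + 1) - qpow θ (-((n : ℝ) + 1)) := by
  simp only [Finset.mul_sum, wt]
  rw [Fin.sum_univ_eq_sum_range
    (fun i : ℕ => qdiff θ * qpow θ (2 * ((i : ℝ) - n / 2))) (n + 1)]
  calc ∑ i ∈ Finset.range (n + 1), qdiff θ * qpow θ (2 * ((i : ℝ) - n / 2))
      = ∑ i ∈ Finset.range (n + 1), (qpow θ (2 * ((i + 1 : ℕ) : ℝ) - n - 1) -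
          qpow θ (2 * (i : ℝ) - n - 1)) := by
        refine Finset.sum_congr rfl fun i _ => ?_
        rw [qdiff, sub_mul, ← qpow_add, ← qpow_add]
        push_cast
        ring_nf
    _ = _ := by
        rw [Finset.sum_range_sub fun i : ℕ => qpow θ (2 * (i : ℝ) - n - 1)]
        push_cast
        ring_nf

lemma qpow_neg_one_mul_casVal (θ : ℝ) (n : ℕ) :
    qpow θ (-1) * casVal θ n = qpow θ n + qpow θ (-((n : ℝ) + 2)) := by
  rw [casVal, mul_add, ← qpow_add, ← qpow_add]
  ring_nf

lemma trace_RR_one_left (θ : ℝ) (n : ℕ) :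
    (RR θ 1 n).trace = (n + 2) * qpow θ n + n * qpow θ (-((n : ℝ) + 2)) := by
  have trace_k_sq : (rho θ n (uq θ .k ^ 2)).trace = ∑ i, qpow θ (2 * wt n i) := by
    simp [rho_uq, rhoGen, Matrix.trace, two_mul, qpow_add, sq]
  have telescope : (1 - qpow θ (-2)) * ∑ i, qpow θ (2 * wt n i) =
      qpow θ n - qpow θ (-((n : ℝ) + 2)) := by
    calc (1 - qpow θ (-2)) * ∑ i, qpow θ (2 * wt n i)
        = qpow θ (-1) * (qdiff θ * ∑ i, qpow θ (2 * wt n i)) := by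
          rw [← mul_assoc, qdiff, mul_sub, ← qpow_add, ← qpow_add]
          norm_num [qpow_zero]
      _ = _ := by
          rw [qdiff_mul_sum_qpow_wt, mul_sub, ← qpow_add, ← qpow_add]
          ring_nf
  rw [RR_one_left, trace_halfSpinEval, monodromy_eq, Matrix.trace_fin_two_of]
  simp only [map_add, map_sub, map_smul, rho_casimir, Matrix.trace_add, Matrix.trace_sub,
    Matrix.trace_smul, trace_k_sq, smul_eq_mul]
  rw [Matrix.trace_one, Fintype.card_fin]
  push_cast
  linear_combination telescope + ((n:ℂ) + 1) * qpow_neg_one_mul_casVal θ n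

lemma rhoTensor_tmul (θ : ℝ) (a b : ℕ) (x y : Uq θ) :
    rhoTensor θ a b (x ⊗ₜ y) = rho θ a x ⊗ₖ rho θ b y := by
  simp [rhoTensor]

lemma rhoBox_uq (θ : ℝ) (a b : ℕ) (g : UqGen) :
    rhoBox θ a b (uq θ g) = rhoTensor θ a b (coprodGen θ g) := by
  simp [rhoBox, coprod, Uq.lift_uq]

/-- The elements `(ρ^{1/2} ⊗ id)(Δ(g))` for the generators `g`, as `2 × 2` matrices over
`U_q(su(2))`. -/
def halfCoprodGen (θ : ℝ) : UqGen → Matrix (Fin 2) (Fin 2) (Uq θ)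
  | .k => !![qpow θ (-(1 / 2)) • uq θ .k, 0; 0, qpow θ (1 / 2) • uq θ .k]
  | .kinv => !![qpow θ (1 / 2) • uq θ .kinv, 0; 0, qpow θ (-(1 / 2)) • uq θ .kinv]
  | .X => !![qpow θ (1 / 2) • uq θ .X, 0; uq θ .k, qpow θ (-(1 / 2)) • uq θ .X]
  | .Y => !![qpow θ (1 / 2) • uq θ .Y, uq θ .k; 0, qpow θ (-(1 / 2)) • uq θ .Y]

lemma rhoBox_one_uq {θ : ℝ} (h : qdiff θ ≠ 0) (n : ℕ) (g : UqGen) :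
    rhoBox θ 1 n (uq θ g) = halfSpinEval θ n (halfCoprodGen θ g) := by
  have rho_k : rho θ 1 (uq θ .k) = !![qpow θ (-(1 / 2)), 0; 0, qpow θ (1 / 2)] := by
    ext i j
    fin_cases i <;> fin_cases j <;> simp [rho_uq, rhoGen, wt_one_zero, wt_one_one]
  have rho_kinv : rho θ 1 (uq θ .kinv) = !![qpow θ (1 / 2), 0; 0, qpow θ (-(1 / 2))] := by
    ext i j
    fin_cases i <;> fin_cases j <;> simp [rho_uq, rhoGen, wt_one_zero, wt_one_one]
  have rho_X : rho θ 1 (uq θ .X) = !![0, 0; 1, 0] := by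
    ext i j
    rw [rho_uq, rhoGen_X_apply]
    fin_cases i <;> fin_cases j <;> simp [ladder_one_zero h]
  have rho_Y : rho θ 1 (uq θ .Y) = !![0, 1; 0, 0] := by
    ext i j
    rw [rho_uq, rhoGen_Y_apply]
    fin_cases i <;> fin_cases j <;> simp [ladder_one_zero h]
  rw [rhoBox_uq]
  ext ⟨s, i⟩ ⟨t, j⟩
  rw [halfSpinEval_apply]
  cases g <;> fin_cases s <;> fin_cases t <;>
    simp [coprodGen, halfCoprodGen, rhoTensor_tmul, rho_k, rho_kinv, rho_X, rho_Y]

lemma halfCoprodGen_casimir (θ : ℝ) :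
    qdiff θ ^ 2 • (halfCoprodGen θ .Y * halfCoprodGen θ .X) +
        qpow θ 1 • halfCoprodGen θ .k ^ 2 + qpow θ (-1) • halfCoprodGen θ .kinv ^ 2 =
      (qpow θ 2 - 1) • monodromy θ + Matrix.diagonal fun _ => qpow θ (-1) • casimir θ := by
  have hr := qpow_ne_zero θ (1 / 2)
  have qpow_one : qpow θ 1 = qpow θ (1 / 2) ^ 2 := by rw [sq, ← qpow_add]; norm_num
  have qpow_two : qpow θ 2 = qpow θ (1 / 2) ^ 4 := by
    rw [show (4 : ℕ) = 2 * 2 by rfl, pow_mul, ← qpow_one, sq, ← qpow_add]; norm_num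
  simp only [monodromy_eq, halfCoprodGen, sq (Matrix.of _), Matrix.mul_fin_two,
    Matrix.diagonal_fin_two, ← Matrix.ext_iff, Fin.forall_fin_two, Matrix.add_apply,
    Matrix.smul_apply, Matrix.of_apply, Matrix.cons_val, mul_zero, zero_mul, add_zero, zero_add,
    smul_zero, mul_smul_comm, smul_mul_assoc, smul_smul, uq_k_X, uq_k_Y, casimir, offCoeff,
    sq (uq θ _), qpow_two, qdiff, qpow_neg, qpow_one]
  refine ⟨⟨?_, ?_⟩, ?_, ?_⟩ <;> match_scalars <;> field_simp <;> ring

/- For spin `1/2` the usual expression of `R'R` through the ribbon element is linear in the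
coproduct of the Casimir element. -/
lemma rhoBox_casimir {θ : ℝ} (h : qdiff θ ≠ 0) (n : ℕ) :
    rhoBox θ 1 n (casimir θ) =
      (qpow θ 2 - 1) • RR θ 1 n + (qpow θ (-1) * casVal θ n) • 1 := by
  rw [RR_one_left, ← halfSpinEval_diagonal_casimir, ← map_smul, ← map_add, ← halfCoprodGen_casimir]
  simp only [casimir, map_add, map_smul, map_mul, map_pow, rhoBox_one_uq h]

/-! ### Quantum traces -/

lemma qtrLeft_smul (θ : ℝ) (a n : ℕ) (c : ℂ)
    (Z : Matrix (Fin (a + 1) × Fin (n + 1)) (Fin (a + 1) × Fin (n + 1)) ℂ) :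
    qtrLeft θ a n (c • Z) = c • qtrLeft θ a n Z := by
  ext i j
  simp [qtrLeft, qtr, Matrix.trace, Matrix.mul_apply, Finset.mul_sum, mul_assoc]

lemma qtrLeft_sub (θ : ℝ) (a n : ℕ)
    (Z W : Matrix (Fin (a + 1) × Fin (n + 1)) (Fin (a + 1) × Fin (n + 1)) ℂ) :
    qtrLeft θ a n (Z - W) = qtrLeft θ a n Z - qtrLeft θ a n W := by
  ext i j
  simp [qtrLeft, qtr, Matrix.trace, Matrix.mul_apply, sub_mul]

lemma qtrLeft_one_one (θ : ℝ) (n : ℕ) :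
    qtrLeft θ 1 n 1 = (qpow θ 1 + qpow θ (-1)) • 1 := by
  rw [← map_one (halfSpinEval θ n), qtrLeft_halfSpinEval]
  simp [add_smul]

lemma qdim_eq_qnum {θ : ℝ} (h : qdiff θ ≠ 0) (n : ℕ) : qdim θ n = qnum θ ((n : ℝ) + 1) := by
  have qdim_eq_sum : qdim θ n = ∑ i, qpow θ (2 * wt n i) := by
    rw [← Equiv.sum_comp Fin.revPerm]
    simp only [qdim, qtr, grouplike, map_mul, rho_uq, rhoGen, one_mul, Matrix.diagonal_mul_diagonal,
      Matrix.trace_diagonal, ← qpow_add]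
    refine Finset.sum_congr rfl fun i _ => ?_
    rw [Fin.revPerm_apply, wt, wt, Fin.val_rev, Nat.cast_sub (by omega)]
    push_cast
    ring_nf
  apply mul_left_cancel₀ h
  rw [qdim_eq_sum, qdiff_mul_sum_qpow_wt, qdiff_mul_qnum h]

lemma qtr_smul_one (θ : ℝ) (n : ℕ) (c : ℂ) : qtr θ n (c • 1) = c * qdim θ n := by
  simp [qdim, qtr]

lemma centralRep_eq_qtrLeft (θ : ℝ) (a n : ℕ) :
    centralRep θ a n = qtrLeft θ a n (RR θ a n) := by
  rw [centralRep, holonomyRep, qtrLeft_smul, kap, smul_inv_smul₀ (qpow_ne_zero _ _)]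

lemma centralRepTrunc_eq_qtrLeft (θ : ℝ) (a n : ℕ)
    (P : Matrix (Fin (a + 1) × Fin (n + 1)) (Fin (a + 1) × Fin (n + 1)) ℂ) :
    centralRepTrunc θ a n P = qtrLeft θ a n (RR θ a n * P) := by
  rw [centralRepTrunc, holonomyRepTrunc, qtrLeft_smul, kap, smul_inv_smul₀ (qpow_ne_zero _ _)]

lemma casVal_eq_cos (θ : ℝ) (n : ℕ) :
    casVal θ n = ((2 * Real.cos (((n : ℝ) + 1) * θ) : ℝ) : ℂ) :=
  qpow_add_qpow_neg θ _

lemma qtr_casVal_smul_one {θ : ℝ} (h : qdiff θ ≠ 0) (n : ℕ) :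
    qtr θ n (casVal θ n • 1) = qnum θ (2 * ((n : ℝ) + 1)) := by
  rw [qtr_smul_one, qdim_eq_qnum h, qnum_two_mul, casVal]

/-! ### The component `V^{K - 1/2}` of `V^{1/2} ⊗ V^K` -/

section Projection

variable {F m p : Type*} [Field F] [CharZero F] [Fintype m] [Fintype p] [DecidableEq p]
  {M : Matrix m m F} {E : Matrix m p F} {C : Matrix p m F}

/- The difference of the two sides is an idempotent of trace zero. -/
lemma eq_mul_of_mul_self_of_trace_eq (hM : M * M = M) (hE : M * E = E) (hC : C * M = C)
    (hCE : C * E = 1) (htr : M.trace = Fintype.card p) : M = E * C := by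
  classical
  have idempotent : IsIdempotentElem (Matrix.toLin' (M - E * C)) := by
    rw [IsIdempotentElem, Module.End.mul_eq_comp, ← Matrix.toLin'_mul]
    congr 1
    rw [Matrix.sub_mul, Matrix.mul_sub, Matrix.mul_sub, hM, ← Matrix.mul_assoc, hE,
      Matrix.mul_assoc, hC, Matrix.mul_assoc, ← Matrix.mul_assoc C, hCE, Matrix.one_mul,
      sub_self, sub_zero]
  have trace_eq_zero : LinearMap.trace F (m → F) (Matrix.toLin' (M - E * C)) = 0 := by
    rw [Matrix.trace_toLin'_eq, Matrix.trace_sub, Matrix.trace_mul_comm E, hCE,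
      Matrix.trace_one, htr, sub_self]
  rw [← sub_eq_zero, ← LinearEquiv.map_eq_zero_iff Matrix.toLin']
  exact LinearMap.IsIdempotentElem.eq_zero_of_trace_eq_zero idempotent trace_eq_zero

lemma sub_smul_one_eq_smul_mul [DecidableEq m] {μ ν : F} (hne : μ - ν ≠ 0)
    (hM : M ^ 2 = (μ + ν) • M - (μ * ν) • 1) (hE : M * E = μ • E) (hC : C * M = μ • C)
    (hCE : C * E = 1)
    (htr : M.trace = μ * Fintype.card p + ν * (Fintype.card m - Fintype.card p)) :
    M - ν • 1 = (μ - ν) • (E * C) := by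
  have hM' : (M - ν • 1) * (M - ν • 1) = (μ - ν) • (M - ν • 1) := by
    simp only [sub_mul, mul_sub, smul_mul_assoc, mul_smul_comm, one_mul, mul_one, ← sq M, hM]
    module
  rw [← eq_mul_of_mul_self_of_trace_eq (M := (μ - ν)⁻¹ • (M - ν • 1)) ?_ ?_ ?_ hCE ?_,
    smul_inv_smul₀ hne]
  · rw [smul_mul_assoc, mul_smul_comm, hM', inv_smul_smul₀ hne]
  · rw [Matrix.smul_mul, Matrix.sub_mul, hE, Matrix.smul_mul, Matrix.one_mul, ← sub_smul,
      inv_smul_smul₀ hne]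
  · rw [Matrix.mul_smul, Matrix.mul_sub, hC, Matrix.mul_smul, Matrix.mul_one, ← sub_smul,
      inv_smul_smul₀ hne]
  · rw [Matrix.trace_smul, Matrix.trace_sub, Matrix.trace_smul, Matrix.trace_one, htr,
      smul_eq_mul, smul_eq_mul]
    field_simp
    ring

end Projection

lemma qpow_two_sub_one_ne_zero {θ : ℝ} (h : qdiff θ ≠ 0) : qpow θ 2 - 1 ≠ 0 := by
  have h' : qpow θ 2 - 1 = qpow θ 1 * qdiff θ := by
    rw [qdiff, mul_sub, qpow_mul_neg, ← qpow_add, one_add_one_eq_two]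
  exact h' ▸ mul_ne_zero (qpow_ne_zero _ _) h

lemma casVal_sub_qpow_mul_casVal_succ (θ : ℝ) (t : ℕ) :
    casVal θ t - qpow θ (-1) * casVal θ (t + 1) = (qpow θ 2 - 1) * qpow θ (-((t : ℝ) + 3)) := by
  rw [casVal, casVal, sub_mul, mul_add, ← qpow_add, ← qpow_add, ← qpow_add]
  push_cast
  ring_nf

section Intertwiner

variable {θ : ℝ} {t : ℕ}

lemma RR_mul_of_intertwines (h : qdiff θ ≠ 0)
    {E : Matrix (Fin (1 + 1) × Fin (t + 1 + 1)) (Fin (t + 1)) ℂ}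
    (hE : rhoBox θ 1 (t + 1) (casimir θ) * E = E * rho θ t (casimir θ)) :
    RR θ 1 (t + 1) * E = qpow θ (-((t : ℝ) + 3)) • E := by
  rw [rhoBox_casimir h, rho_casimir, Matrix.add_mul, Matrix.smul_mul, Matrix.smul_mul,
    Matrix.one_mul, Matrix.mul_smul, Matrix.mul_one, ← eq_sub_iff_add_eq, ← sub_smul,
    casVal_sub_qpow_mul_casVal_succ, mul_smul] at hE
  exact smul_right_injective _ (qpow_two_sub_one_ne_zero h) hE

lemma mul_RR_of_intertwines (h : qdiff θ ≠ 0)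
    {C : Matrix (Fin (t + 1)) (Fin (1 + 1) × Fin (t + 1 + 1)) ℂ}
    (hC : C * rhoBox θ 1 (t + 1) (casimir θ) = rho θ t (casimir θ) * C) :
    C * RR θ 1 (t + 1) = qpow θ (-((t : ℝ) + 3)) • C := by
  rw [rhoBox_casimir h, rho_casimir, Matrix.mul_add, Matrix.mul_smul, Matrix.mul_smul,
    Matrix.mul_one, Matrix.smul_mul, Matrix.one_mul, ← eq_sub_iff_add_eq, ← sub_smul,
    casVal_sub_qpow_mul_casVal_succ, mul_smul] at hC
  exact smul_right_injective _ (qpow_two_sub_one_ne_zero h) hC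

/- The projector onto `V^{K - 1/2}` is a linear function of the monodromy. -/
lemma RR_sub_smul_one_eq_smul_mul
    (hne : qpow θ (-((t : ℝ) + 3)) - qpow θ ((t : ℝ) + 1) ≠ 0)
    {E : Matrix (Fin (1 + 1) × Fin (t + 1 + 1)) (Fin (t + 1)) ℂ}
    {C : Matrix (Fin (t + 1)) (Fin (1 + 1) × Fin (t + 1 + 1)) ℂ}
    (hE : RR θ 1 (t + 1) * E = qpow θ (-((t : ℝ) + 3)) • E)
    (hC : C * RR θ 1 (t + 1) = qpow θ (-((t : ℝ) + 3)) • C) (hCE : C * E = 1) :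
    RR θ 1 (t + 1) - qpow θ ((t : ℝ) + 1) • 1 =
      (qpow θ (-((t : ℝ) + 3)) - qpow θ ((t : ℝ) + 1)) • (E * C) := by
  refine sub_smul_one_eq_smul_mul hne ?_ hE hC hCE ?_
  · rw [RR_one_left_sq, qpow_neg_one_mul_casVal, ← qpow_add]
    push_cast
    ring_nf
  · rw [trace_RR_one_left, Fintype.card_prod, Fintype.card_fin, Fintype.card_fin, Fintype.card_fin]
    push_cast
    ring_nf

/- When `q^{t + 3} = 1`, the monodromy fixes the component `V^{t / 2}` and takes the value `q⁻²` on
its complement, whence `(1 - q⁻²) R'R P = R'R - q⁻²`. -/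
lemma qtrLeft_RR_mul_of_intertwines (h : qdiff θ ≠ 0) (hq : qpow θ ((t : ℝ) + 3) = 1)
    {E : Matrix (Fin (1 + 1) × Fin (t + 1 + 1)) (Fin (t + 1)) ℂ}
    {C : Matrix (Fin (t + 1)) (Fin (1 + 1) × Fin (t + 1 + 1)) ℂ}
    (hE : rhoBox θ 1 (t + 1) (casimir θ) * E = E * rho θ t (casimir θ))
    (hC : C * rhoBox θ 1 (t + 1) (casimir θ) = rho θ t (casimir θ) * C) (hCE : C * E = 1) :
    qtrLeft θ 1 (t + 1) (RR θ 1 (t + 1) * (E * C)) = casVal θ (t + 1) • 1 := by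
  have μ_eq : qpow θ (-((t : ℝ) + 3)) = 1 := by rw [qpow_neg, hq, inv_one]
  have ν_eq : qpow θ ((t : ℝ) + 1) = qpow θ (-2) := by
    rw [show (t : ℝ) + 1 = (t + 3) + -2 by ring, qpow_add, hq, one_mul]
  have casVal_eq : casVal θ (t + 1) = qpow θ 1 + qpow θ (-1) := by
    have h' : qpow θ ((t : ℝ) + 2) = qpow θ (-1) := by
      rw [show (t : ℝ) + 2 = (t + 3) + -1 by ring, qpow_add, hq, one_mul]
    rw [casVal, Nat.cast_succ, add_assoc, one_add_one_eq_two, qpow_neg _ (_ + _), h', ← qpow_neg,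
      neg_neg, add_comm]
  have hne : 1 - qpow θ (-2) ≠ 0 := by
    rw [qpow_neg]
    exact sub_ne_zero.mpr (inv_ne_one.mpr (sub_ne_zero.mp (qpow_two_sub_one_ne_zero h))).symm
  have hRE := RR_mul_of_intertwines h hE
  have hCR := mul_RR_of_intertwines h hC
  have hlin := RR_sub_smul_one_eq_smul_mul (by rwa [μ_eq, ν_eq]) hRE hCR hCE
  rw [μ_eq, ν_eq] at hlin
  apply smul_right_injective _ hne
  beta_reduce
  rw [← Matrix.mul_assoc, hRE, μ_eq, one_smul, ← qtrLeft_smul, ← hlin, qtrLeft_sub, qtrLeft_smul,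
    qtrLeft_RR_one_left, qtrLeft_one_one, casVal_eq]
  module

lemma admissible_one_self (t : ℕ) : admissible (t + 1) 1 (t + 1) = {t} := by
  ext c
  simp only [admissible, Finset.mem_filter, Finset.mem_range, Finset.mem_singleton, Nat.even_iff]
  omega

lemma qtrLeft_RR_mul_of_isTruncation_top (h : qdiff θ ≠ 0) (hq : qpow θ ((t : ℝ) + 3) = 1)
    {P : Matrix (Fin (1 + 1) × Fin (t + 1 + 1)) (Fin (1 + 1) × Fin (t + 1 + 1)) ℂ}
    (hP : IsTruncation θ (t + 1) 1 (t + 1) P) :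
    qtrLeft θ 1 (t + 1) (RR θ 1 (t + 1) * P) = casVal θ (t + 1) • 1 := by
  rcases hP with ⟨hle, -⟩ | ⟨-, E, C, hEC, hCE, -, rfl⟩
  · omega
  · have ht : t ∈ admissible (t + 1) 1 (t + 1) := by
      rw [admissible_one_self, Finset.mem_singleton]
    rw [admissible_one_self, Finset.sum_singleton]
    exact qtrLeft_RR_mul_of_intertwines h hq (hEC t ht _).1 (hEC t ht _).2 (hCE t ht)

end Intertwiner

/-! ### Existence of the truncation -/

lemma exists_mul_self_eq_and_mul_eq {F : Type*} [Field F] [IsAlgClosed F] {x u v p : F}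
    (hx : x * x = u) (hp : p * p = u * v) : ∃ y, y * y = v ∧ x * y = p := by
  subst hx
  rcases eq_or_ne x 0 with rfl | hx0
  · obtain ⟨y, rfl⟩ := IsAlgClosed.exists_eq_mul_self v
    have hp0 : p = 0 := by simpa using hp
    exact ⟨y, rfl, by rw [hp0, zero_mul]⟩
  · exact ⟨p / x, by rw [div_mul_div_comm, hp, mul_div_cancel_left₀ _ (mul_self_ne_zero.mpr hx0)],
      mul_div_cancel₀ _ hx0⟩

lemma exists_mul_self_eq_and_mul_succ_eq {F : Type*} [Field F] [IsAlgClosed F] {u p : ℕ → F}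
    (h : ∀ j, p j * p j = u j * u (j + 1)) :
    ∃ s : ℕ → F, (∀ j, s j * s j = u j) ∧ ∀ j, s j * s (j + 1) = p j := by
  obtain ⟨s₀, hs₀⟩ := IsAlgClosed.exists_eq_mul_self (u 0)
  choose next hnext using fun j (x : {x : F // x * x = u j}) =>
    exists_mul_self_eq_and_mul_eq x.2 (h j)
  let s : ∀ j, {x : F // x * x = u j} :=
    Nat.rec ⟨s₀, hs₀.symm⟩ fun j x => ⟨next j x, (hnext j x).1⟩
  exact ⟨fun j => (s j).1, fun j => (s j).2, fun j => (hnext j (s j)).2⟩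

/-- Square roots `a i` of `[t + 1 - i]` and `b i` of `[i + 1]` whose signs are chosen so that the
coefficients of `X` and `Y` on `V^{(t + 1) / 2}` and on `V^{t / 2}` factor through them. -/
structure IsLadderFactorization (θ : ℝ) (t : ℕ) (a b : ℕ → ℂ) : Prop where
  mul_self_left (i : ℕ) : a i * a i = qnum θ ((t : ℝ) + 1 - i)
  mul_self_right (i : ℕ) : b i * b i = qnum θ ((i : ℝ) + 1)
  left_mul_right (i : ℕ) : a i * b i = ladder θ (t + 1) i
  right_mul_left_succ (i : ℕ) : b i * a (i + 1) = ladder θ t i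

/- The roots are chosen successively along the sequence `a 0, b 0, a 1, b 1, …`, in which the
product of any two neighbours is prescribed. -/
lemma exists_isLadderFactorization (θ : ℝ) (t : ℕ) : ∃ a b, IsLadderFactorization θ t a b := by
  let u (j : ℕ) : ℂ :=
    if Even j then qnum θ ((t : ℝ) + 1 - (j / 2 : ℕ)) else qnum θ (((j / 2 : ℕ) : ℝ) + 1)
  let p (j : ℕ) : ℂ := if Even j then ladder θ (t + 1) (j / 2) else ladder θ t (j / 2)
  have half_odd (i : ℕ) : (2 * i + 1) / 2 = i := by omega
  have u_even (i : ℕ) : u (2 * i) = qnum θ ((t : ℝ) + 1 - i) := by simp [u]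
  have u_odd (i : ℕ) : u (2 * i + 1) = qnum θ ((i : ℝ) + 1) := by simp [u, half_odd]
  have p_even (i : ℕ) : p (2 * i) = ladder θ (t + 1) i := by simp [p]
  have p_odd (i : ℕ) : p (2 * i + 1) = ladder θ t i := by simp [p, half_odd]
  have p_mul_self (j : ℕ) : p j * p j = u j * u (j + 1) := by
    obtain ⟨i, rfl | rfl⟩ := j.even_or_odd'
    · rw [p_even, u_even, u_odd, ladder_mul_self, Nat.cast_succ]
    · rw [p_odd, show 2 * i + 1 + 1 = 2 * (i + 1) by ring, u_odd, u_even, ladder_mul_self, mul_comm,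
        Nat.cast_succ, add_sub_add_right_eq_sub]
  obtain ⟨s, s_mul_self, s_mul_succ⟩ := exists_mul_self_eq_and_mul_succ_eq p_mul_self
  exact ⟨fun i => s (2 * i), fun i => s (2 * i + 1), fun i => by rw [s_mul_self, u_even],
    fun i => by rw [s_mul_self, u_odd], fun i => by rw [s_mul_succ, p_even],
    fun i => by rw [← p_odd, ← s_mul_succ]; rfl⟩

lemma qnum_add {θ : ℝ} (h : qdiff θ ≠ 0) (x y : ℝ) :
    qnum θ (x + y) = qpow θ y * qnum θ x + qpow θ (-x) * qnum θ y := by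
  apply mul_left_cancel₀ h
  rw [mul_add, mul_left_comm, mul_left_comm (qdiff θ), qdiff_mul_qnum h, qdiff_mul_qnum h,
    qdiff_mul_qnum h, mul_sub, mul_sub]
  simp only [← qpow_add]
  ring_nf

section ClebschGordan

/-- The Clebsch–Gordan coefficient of `e_{1/2} ⊗ e_i` in the image of `e_i ∈ V^{t / 2}`. -/
def cgUp (θ : ℝ) (a : ℕ → ℂ) (i : ℕ) : ℂ := qpow θ (i / 2) * a i

/-- The Clebsch–Gordan coefficient of `e_{-1/2} ⊗ e_{i + 1}` in the image of `e_i ∈ V^{t / 2}`. -/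
def cgDown (θ : ℝ) (t : ℕ) (b : ℕ → ℂ) (i : ℕ) : ℂ := -(qpow θ (((i : ℝ) - t - 2) / 2) * b i)

/-- The matrix of the map `e_i ↦ α_i e_{1/2} ⊗ e_i + β_i e_{-1/2} ⊗ e_{i + 1}` from `V^{t / 2}` to
`V^{1/2} ⊗ V^{(t + 1) / 2}`. -/
def embedMat (t : ℕ) (α β : ℕ → ℂ) :
    Matrix (Fin (1 + 1) × Fin (t + 1 + 1)) (Fin (t + 1)) ℂ :=
  Matrix.of fun p i => if p.1 = 1 then (if p.2 = i.castSucc then α i else 0)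
    else (if p.2 = i.succ then β i else 0)

variable {θ : ℝ} {t : ℕ} {a b α β : ℕ → ℂ}

lemma cgUp_mul_self_add_cgDown_mul_self (h : qdiff θ ≠ 0) (hab : IsLadderFactorization θ t a b)
    (i : ℕ) :
    cgUp θ a i * cgUp θ a i + cgDown θ t b i * cgDown θ t b i =
      qpow θ (-1) * qnum θ ((t : ℝ) + 2) := by
  have up : qpow θ ((i : ℝ) / 2) * qpow θ ((i : ℝ) / 2) = qpow θ (-1) * qpow θ ((i : ℝ) + 1) := by
    simp only [← qpow_add]; ring_nf
  have down : qpow θ (((i : ℝ) - t - 2) / 2) * qpow θ (((i : ℝ) - t - 2) / 2) =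
      qpow θ (-1) * qpow θ (-((t : ℝ) + 1 - i)) := by
    simp only [← qpow_add]; ring_nf
  rw [show (t : ℝ) + 2 = (t + 1 - i) + (i + 1) by ring, qnum_add h, ← hab.mul_self_left,
    ← hab.mul_self_right, cgUp, cgDown]
  linear_combination a i * a i * up + b i * b i * down

lemma ladder_mul_cgDown (hab : IsLadderFactorization θ t a b) (i : ℕ) :
    qpow θ (1 / 2) * ladder θ (t + 1) (i + 1) * cgDown θ t b i =
      cgDown θ t b (i + 1) * ladder θ t i := by
  rw [← hab.left_mul_right, ← hab.right_mul_left_succ, cgDown, cgDown,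
    show (((i + 1 : ℕ) : ℝ) - t - 2) / 2 = 1 / 2 + ((i : ℝ) - t - 2) / 2 by push_cast; ring,
    qpow_add]
  ring

lemma ladder_mul_cgUp_succ (hab : IsLadderFactorization θ t a b) (i : ℕ) :
    qpow θ (-(1 / 2)) * ladder θ (t + 1) i * cgUp θ a (i + 1) = cgUp θ a i * ladder θ t i := by
  rw [← hab.left_mul_right, ← hab.right_mul_left_succ, cgUp, cgUp,
    show (i : ℝ) / 2 = -(1 / 2) + ((i + 1 : ℕ) : ℝ) / 2 by push_cast; ring, qpow_add]
  ring

lemma qpow_mul_cgDown_add_ladder_mul_cgUp (h : qdiff θ ≠ 0) (hab : IsLadderFactorization θ t a b)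
    (i : ℕ) :
    qpow θ ((i : ℝ) + 1 - (t + 1) / 2) * cgDown θ t b i +
      qpow θ (-(1 / 2)) * ladder θ (t + 1) i * cgUp θ a i = cgUp θ a (i + 1) * ladder θ t i := by
  have hsum : qnum θ ((t : ℝ) + 1 - i) =
      qpow θ 1 * qnum θ ((t : ℝ) - i) + qpow θ (-((t : ℝ) - i)) := by
    rw [add_sub_right_comm, qnum_add h, qnum_one h, mul_one]
  have ha : a (i + 1) * a (i + 1) = qnum θ ((t : ℝ) - i) := by
    rw [hab.mul_self_left, Nat.cast_succ, add_sub_add_right_eq_sub]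
  have down : qpow θ ((i : ℝ) + 1 - (t + 1) / 2) * qpow θ (((i : ℝ) - t - 2) / 2) =
      qpow θ (-(1 / 2)) * qpow θ ((i : ℝ) / 2) * qpow θ (-((t : ℝ) - i)) := by
    simp only [← qpow_add]; ring_nf
  have up : qpow θ (((i + 1 : ℕ) : ℝ) / 2) =
      qpow θ (-(1 / 2)) * qpow θ ((i : ℝ) / 2) * qpow θ 1 := by
    simp only [← qpow_add]; push_cast; ring_nf
  rw [← hab.left_mul_right, ← hab.right_mul_left_succ, cgUp, cgUp, cgDown, up]
  linear_combination (-b i) * down + qpow θ (-(1 / 2)) * qpow θ ((i : ℝ) / 2) * b i *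
    (hab.mul_self_left i + hsum - qpow θ 1 * ha)

lemma ladder_mul_cgDown_add_qpow_mul_cgUp (h : qdiff θ ≠ 0) (hab : IsLadderFactorization θ t a b)
    (i : ℕ) :
    qpow θ (1 / 2) * ladder θ (t + 1) i * cgDown θ t b i +
        qpow θ ((i : ℝ) - (t + 1) / 2) * cgUp θ a i =
      -(qpow θ (((i : ℝ) - t - 3) / 2) * a i * qnum θ i) := by
  have hsum : qnum θ ((i : ℝ) + 1) = qpow θ (-1) * qnum θ i + qpow θ i := by
    rw [add_comm, qnum_add h, qnum_one h, mul_one, add_comm]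
  have up : qpow θ ((i : ℝ) - (t + 1) / 2) * qpow θ ((i : ℝ) / 2) =
      qpow θ (1 / 2) * qpow θ (((i : ℝ) - t - 2) / 2) * qpow θ i := by
    simp only [← qpow_add]; ring_nf
  have down : qpow θ (((i : ℝ) - t - 3) / 2) =
      qpow θ (1 / 2) * qpow θ (((i : ℝ) - t - 2) / 2) * qpow θ (-1) := by
    simp only [← qpow_add]; ring_nf
  rw [← hab.left_mul_right, cgUp, cgDown, down]
  linear_combination a i * up - qpow θ (1 / 2) * qpow θ (((i : ℝ) - t - 2) / 2) * a i *
    (hab.mul_self_right i + hsum)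

lemma ladder_mul_cgDown_succ_add_qpow_mul_cgUp_succ (h : qdiff θ ≠ 0)
    (hab : IsLadderFactorization θ t a b) (i : ℕ) :
    qpow θ (1 / 2) * ladder θ (t + 1) (i + 1) * cgDown θ t b (i + 1) +
        qpow θ ((i + 1 : ℕ) - ((t : ℝ) + 1) / 2) * cgUp θ a (i + 1) =
      cgDown θ t b i * ladder θ t i := by
  rw [ladder_mul_cgDown_add_qpow_mul_cgUp h hab, ← hab.right_mul_left_succ, cgDown, Nat.cast_succ,
    ← hab.mul_self_right, show ((i : ℝ) + 1 - t - 3) / 2 = (i - t - 2) / 2 by ring]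
  ring

lemma ladder_self (θ : ℝ) (n : ℕ) : ladder θ n n = 0 := by
  rw [← mul_self_eq_zero, ladder_mul_self, sub_self, qnum_zero, zero_mul]

lemma embedMat_transpose_mul_self :
    (embedMat t α β)ᵀ * embedMat t α β =
      Matrix.diagonal fun i : Fin (t + 1) => α i * α i + β i * β i := by
  ext i j
  rw [Matrix.mul_apply, Fintype.sum_prod_type, Fin.sum_univ_two]
  rcases eq_or_ne i j with rfl | hij
  · simp [embedMat, add_comm]
  · simp [embedMat, hij, hij.symm]

lemma halfSpinEval_mul_embedMat_eq {A B C D : Uq θ} {N : Matrix (Fin (t + 1)) (Fin (t + 1)) ℂ}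
    (h_bot : ∀ i : Fin (t + 1), rho θ (t + 1) A 0 i.succ * β i +
      rho θ (t + 1) B 0 i.castSucc * α i = 0)
    (h_succ : ∀ j i : Fin (t + 1), rho θ (t + 1) A j.succ i.succ * β i +
      rho θ (t + 1) B j.succ i.castSucc * α i = β j * N j i)
    (h_castSucc : ∀ j i : Fin (t + 1), rho θ (t + 1) C j.castSucc i.succ * β i +
      rho θ (t + 1) D j.castSucc i.castSucc * α i = α j * N j i)
    (h_top : ∀ i : Fin (t + 1), rho θ (t + 1) C (Fin.last _) i.succ * β i +
      rho θ (t + 1) D (Fin.last _) i.castSucc * α i = 0) :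
    halfSpinEval θ (t + 1) !![A, B; C, D] * embedMat t α β = embedMat t α β * N := by
  have mul_embedMat (s : Fin (1 + 1)) (j) (i : Fin (t + 1)) :
      (halfSpinEval θ (t + 1) !![A, B; C, D] * embedMat t α β) (s, j) i =
        rho θ (t + 1) (!![A, B; C, D] s 0) j i.succ * β i +
          rho θ (t + 1) (!![A, B; C, D] s 1) j i.castSucc * α i := by
    simp [embedMat, Matrix.mul_apply, Fintype.sum_prod_type, Fin.sum_univ_two, halfSpinEval_apply]
  ext ⟨s, j⟩ i
  rw [mul_embedMat]
  fin_cases s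
  · refine Fin.cases ((h_bot i).trans ?_) (fun j => (h_succ j i).trans ?_) j
    · simp [embedMat, Matrix.mul_apply, (Fin.succ_ne_zero _).symm]
    · simp [embedMat, Matrix.mul_apply]
  · refine Fin.lastCases ((h_top i).trans ?_) (fun j => (h_castSucc j i).trans ?_) j
    · simp [embedMat, Matrix.mul_apply, (Fin.castSucc_lt_last _).ne']
    · simp [embedMat, Matrix.mul_apply]

lemma halfCoprodGen_k_mul_embedMat :
    halfSpinEval θ (t + 1) (halfCoprodGen θ .k) * embedMat t α β =
      embedMat t α β * rhoGen θ t .k := by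
  have wt_succ (i : Fin (t + 1)) : wt t i = -(1 / 2) + wt (t + 1) i.succ := by
    simp only [wt, Fin.val_succ]; push_cast; ring
  have wt_castSucc (i : Fin (t + 1)) : wt t i = 1 / 2 + wt (t + 1) i.castSucc := by
    simp only [wt, Fin.val_castSucc]; push_cast; ring
  apply halfSpinEval_mul_embedMat_eq <;> intros <;>
    simp only [map_smul, map_zero, rho_uq, rhoGen, Matrix.smul_apply, Matrix.zero_apply,
      Matrix.diagonal_apply, smul_eq_mul, zero_mul, add_zero, zero_add]
  case h_bot i => simp [(Fin.succ_ne_zero i).symm]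
  case h_succ j i =>
    rcases eq_or_ne j i with rfl | hji
    · simp only [if_true, wt_succ, qpow_add]; ring
    · simp [hji]
  case h_castSucc j i =>
    rcases eq_or_ne j i with rfl | hji
    · simp only [if_true, wt_castSucc, qpow_add]; ring
    · simp [hji]
  case h_top i => simp [(Fin.castSucc_lt_last i).ne']

lemma halfCoprodGen_X_mul_embedMat (h : qdiff θ ≠ 0) (hab : IsLadderFactorization θ t a b) :
    halfSpinEval θ (t + 1) (halfCoprodGen θ .X) * embedMat t (cgUp θ a) (cgDown θ t b) =
      embedMat t (cgUp θ a) (cgDown θ t b) * rhoGen θ t .X := by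
  have k_apply (j) (i : Fin (t + 1)) : rhoGen θ (t + 1) .k j i.succ =
      if (j : ℕ) = i + 1 then qpow θ ((i : ℝ) + 1 - (t + 1) / 2) else 0 := by
    simp only [rhoGen, Matrix.diagonal_apply, Fin.ext_iff, Fin.val_succ, wt]
    split_ifs with hij
    · rw [hij, Nat.cast_succ, Nat.cast_succ]
    · rfl
  apply halfSpinEval_mul_embedMat_eq <;> intros <;>
    simp only [map_smul, map_zero, rho_uq, k_apply, rhoGen_X_apply, Matrix.smul_apply,
      Matrix.zero_apply, smul_eq_mul, zero_mul, add_zero, Fin.val_succ, Fin.val_castSucc,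
      Fin.val_last, Nat.add_right_cancel_iff]
  case h_bot i => simp
  case h_succ j i =>
    split_ifs with hji
    · rw [hji, ladder_mul_cgDown hab]
    · simp
  case h_castSucc j i =>
    split_ifs with hji
    · rw [hji, qpow_mul_cgDown_add_ladder_mul_cgUp h hab]
    · simp
  case h_top i =>
    split_ifs with hti
    · rw [qpow_mul_cgDown_add_ladder_mul_cgUp h hab, ← hti, ladder_self, mul_zero]
    · simp

lemma halfCoprodGen_Y_mul_embedMat (h : qdiff θ ≠ 0) (hab : IsLadderFactorization θ t a b) :
    halfSpinEval θ (t + 1) (halfCoprodGen θ .Y) * embedMat t (cgUp θ a) (cgDown θ t b) =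
      embedMat t (cgUp θ a) (cgDown θ t b) * rhoGen θ t .Y := by
  have k_apply (j) (i : Fin (t + 1)) : rhoGen θ (t + 1) .k j i.castSucc =
      if (i : ℕ) = j then qpow θ ((i : ℝ) - (t + 1) / 2) else 0 := by
    simp only [rhoGen, Matrix.diagonal_apply, Fin.ext_iff, Fin.val_castSucc, wt, eq_comm]
    split_ifs with hij
    · rw [hij, Nat.cast_succ]
    · rfl
  apply halfSpinEval_mul_embedMat_eq <;> intros <;>
    simp only [map_smul, map_zero, rho_uq, k_apply, rhoGen_Y_apply, Matrix.smul_apply,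
      Matrix.zero_apply, smul_eq_mul, zero_mul, zero_add, Fin.val_succ, Fin.val_castSucc,
      Fin.val_last, Nat.add_right_cancel_iff]
  case h_bot i =>
    split_ifs with hi
    · obtain rfl : i = 0 := Fin.ext hi
      simpa [qnum_zero] using ladder_mul_cgDown_add_qpow_mul_cgUp h hab 0
    · simp
  case h_succ j i =>
    split_ifs with hij
    · rw [hij, ladder_mul_cgDown_succ_add_qpow_mul_cgUp_succ h hab]
    · simp
  case h_castSucc j i =>
    split_ifs with hij
    · rw [hij, ladder_mul_cgUp_succ hab]
    · simp
  case h_top i => simp; omega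

end ClebschGordan

lemma intertwines_of_intertwines_uq {θ : ℝ} {m p : Type} [Fintype m] [DecidableEq m] [Fintype p]
    [DecidableEq p] {f : Uq θ →ₐ[ℂ] Matrix m m ℂ} {g : Uq θ →ₐ[ℂ] Matrix p p ℂ}
    {E : Matrix m p ℂ} (h : ∀ x, f (uq θ x) * E = E * g (uq θ x)) (ξ : Uq θ) :
    f ξ * E = E * g ξ := by
  obtain ⟨x, rfl⟩ := RingQuot.mkAlgHom_surjective ℂ (UqRel θ) ξ
  induction x using FreeAlgebra.induction with
  | grade0 c => simp [Algebra.algebraMap_eq_smul_one]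
  | grade1 x => exact h x
  | mul x y hx hy => simp only [map_mul, Matrix.mul_assoc, hy, ← Matrix.mul_assoc _ E, hx]
  | add x y hx hy => simp only [map_add, Matrix.add_mul, Matrix.mul_add, hx, hy]

lemma intertwines_kinv_of_intertwines_k {θ : ℝ} {m p : Type} [Fintype m] [DecidableEq m] [Fintype p]
    [DecidableEq p] {f : Uq θ →ₐ[ℂ] Matrix m m ℂ} {g : Uq θ →ₐ[ℂ] Matrix p p ℂ}
    {E : Matrix m p ℂ} (h : f (uq θ .k) * E = E * g (uq θ .k)) :
    f (uq θ .kinv) * E = E * g (uq θ .kinv) := by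
  calc f (uq θ .kinv) * E = f (uq θ .kinv) * (E * g (uq θ .k)) * g (uq θ .kinv) := by
        rw [Matrix.mul_assoc, Matrix.mul_assoc, ← map_mul, uq_k_kinv, map_one, Matrix.mul_one]
    _ = E * g (uq θ .kinv) := by
        rw [← h, ← Matrix.mul_assoc, ← map_mul, uq_kinv_k, map_one, Matrix.one_mul]

lemma exists_intertwiner {θ : ℝ} (h : qdiff θ ≠ 0) (t : ℕ) :
    ∃ E : Matrix (Fin (1 + 1) × Fin (t + 1 + 1)) (Fin (t + 1)) ℂ,
      (∀ g, rhoBox θ 1 (t + 1) (uq θ g) * E = E * rho θ t (uq θ g)) ∧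
      Eᵀ * E = (qpow θ (-1) * qnum θ ((t : ℝ) + 2)) • 1 := by
  obtain ⟨a, b, hab⟩ := exists_isLadderFactorization θ t
  have intertwines_k : rhoBox θ 1 (t + 1) (uq θ .k) * embedMat t (cgUp θ a) (cgDown θ t b) =
      embedMat t (cgUp θ a) (cgDown θ t b) * rho θ t (uq θ .k) := by
    rw [rhoBox_one_uq h, rho_uq, halfCoprodGen_k_mul_embedMat]
  refine ⟨embedMat t (cgUp θ a) (cgDown θ t b), fun g => ?_, ?_⟩
  · cases g with
    | k => exact intertwines_k
    | kinv => exact intertwines_kinv_of_intertwines_k intertwines_k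
    | X => rw [rhoBox_one_uq h, rho_uq, halfCoprodGen_X_mul_embedMat h hab]
    | Y => rw [rhoBox_one_uq h, rho_uq, halfCoprodGen_Y_mul_embedMat h hab]
  · simp only [embedMat_transpose_mul_self, cgUp_mul_self_add_cgDown_mul_self h hab,
      Matrix.smul_one_eq_diagonal]

/-- Transposition of generators: it exchanges `X` and `Y`. -/
def UqGen.transpose : UqGen → UqGen
  | .k => .k
  | .kinv => .kinv
  | .X => .Y
  | .Y => .X

lemma rhoGen_transpose (θ : ℝ) (n : ℕ) (g : UqGen) :
    (rhoGen θ n g)ᵀ = rhoGen θ n g.transpose := by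
  cases g with
  | k => exact Matrix.diagonal_transpose _
  | kinv => exact Matrix.diagonal_transpose _
  | X => exact rhoGen_X_transpose θ n
  | Y => rw [UqGen.transpose, ← rhoGen_X_transpose, Matrix.transpose_transpose]

lemma rhoBox_uq_transpose (θ : ℝ) (a b : ℕ) (g : UqGen) :
    (rhoBox θ a b (uq θ g))ᵀ = rhoBox θ a b (uq θ g.transpose) := by
  cases g <;>
    simp only [rhoBox_uq, UqGen.transpose, coprodGen, map_add, rhoTensor_tmul,
      Matrix.transpose_add, ← Matrix.kroneckerMap_transpose, rho_uq, rhoGen_transpose]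

lemma transpose_intertwines {θ : ℝ} {a b c : ℕ}
    {E : Matrix (Fin (a + 1) × Fin (b + 1)) (Fin (c + 1)) ℂ}
    (h : ∀ g, rhoBox θ a b (uq θ g) * E = E * rho θ c (uq θ g)) (g : UqGen) :
    rho θ c (uq θ g) * Eᵀ = Eᵀ * rhoBox θ a b (uq θ g) := by
  apply Matrix.transpose_injective
  rw [Matrix.transpose_mul, Matrix.transpose_mul, Matrix.transpose_transpose, rho_uq,
    rhoGen_transpose, rhoBox_uq_transpose, h, rho_uq]

lemma exists_isTruncation_top {θ : ℝ} (h : qdiff θ ≠ 0) {t : ℕ} (hq : qnum θ ((t : ℝ) + 2) ≠ 0) :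
    ∃ P, IsTruncation θ (t + 1) 1 (t + 1) P := by
  obtain ⟨E, hE, hEE⟩ := exists_intertwiner h t
  set c := qpow θ (-1) * qnum θ ((t : ℝ) + 2)
  have hc : c ≠ 0 := mul_ne_zero (qpow_ne_zero _ _) hq
  refine ⟨E * (c⁻¹ • Eᵀ), Or.inr ⟨by omega, Function.update 0 t E,
    Function.update 0 t (c⁻¹ • Eᵀ), ?_⟩⟩
  simp only [admissible_one_self, Finset.mem_singleton, forall_eq, Function.update_self,
    Finset.sum_singleton]
  refine ⟨fun ξ => ⟨intertwines_of_intertwines_uq hE ξ, ?_⟩, ?_, fun hne => absurd rfl hne, trivial⟩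
  · rw [Matrix.smul_mul, Matrix.mul_smul,
      intertwines_of_intertwines_uq (transpose_intertwines hE) ξ]
  · rw [Matrix.smul_mul, hEE, inv_smul_smul₀ hc]

/-! ### Roots of unity -/

section RootOfUnity

variable {θ : ℝ} {k n : ℕ}

lemma pos_of_qpow_add_two_eq_one (h : qdiff θ ≠ 0) (hq : qpow θ ((k : ℝ) + 2) = 1) : 0 < k := by
  refine Nat.pos_of_ne_zero ?_
  rintro rfl
  rw [Nat.cast_zero, zero_add] at hq
  exact qpow_two_sub_one_ne_zero h (sub_eq_zero.mpr hq)

lemma qnum_add_one_ne_zero_of_qpow_add_two_eq_one (h : qdiff θ ≠ 0)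
    (hq : qpow θ ((k : ℝ) + 2) = 1) : qnum θ ((k : ℝ) + 1) ≠ 0 := by
  have hqpow : qpow θ ((k : ℝ) + 1) = qpow θ (-1) := by
    rw [show (k : ℝ) + 1 = k + 2 + -1 by ring, qpow_add, hq, one_mul]
  have hqnum : qdiff θ * qnum θ ((k : ℝ) + 1) = -qdiff θ := by
    rw [qdiff_mul_qnum h, qpow_neg _ (_ + _), hqpow, ← qpow_neg, neg_neg, qdiff, neg_sub]
  exact right_ne_zero_of_mul (hqnum ▸ neg_ne_zero.mpr h)

lemma exists_isTruncation (h : qdiff θ ≠ 0) (hq : qpow θ ((k : ℝ) + 2) = 1) (hn : n ≤ k) :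
    ∃ P, IsTruncation θ k 1 n P := by
  rcases hn.lt_or_eq with hlt | rfl
  · exact ⟨1, Or.inl ⟨by omega, rfl⟩⟩
  · have hqnum := qnum_add_one_ne_zero_of_qpow_add_two_eq_one h hq
    obtain ⟨t, rfl⟩ := Nat.exists_eq_add_one.mpr (pos_of_qpow_add_two_eq_one h hq)
    rw [Nat.cast_succ, add_assoc, one_add_one_eq_two] at hqnum
    exact exists_isTruncation_top h hqnum

lemma qtrLeft_RR_mul_of_isTruncation (h : qdiff θ ≠ 0) (hq : qpow θ ((k : ℝ) + 2) = 1)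
    (hn : n ≤ k) {P : Matrix (Fin (1 + 1) × Fin (n + 1)) (Fin (1 + 1) × Fin (n + 1)) ℂ}
    (hP : IsTruncation θ k 1 n P) :
    qtrLeft θ 1 n (RR θ 1 n * P) = casVal θ n • 1 := by
  rcases hn.lt_or_eq with hlt | rfl
  · rcases hP with ⟨-, rfl⟩ | ⟨hlt', -⟩
    · rw [mul_one, qtrLeft_RR_one_left]
    · omega
  · obtain ⟨t, rfl⟩ := Nat.exists_eq_add_one.mpr (pos_of_qpow_add_two_eq_one h hq)
    refine qtrLeft_RR_mul_of_isTruncation_top h ?_ hP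
    rwa [Nat.cast_succ, add_assoc, show (1 : ℝ) + 2 = 3 by norm_num] at hq

lemma centralRepTrunc_one_left (h : qdiff θ ≠ 0) (hq : qpow θ ((k : ℝ) + 2) = 1) (hn : n ≤ k)
    {P : Matrix (Fin (1 + 1) × Fin (n + 1)) (Fin (1 + 1) × Fin (n + 1)) ℂ}
    (hP : IsTruncation θ k 1 n P) :
    centralRepTrunc θ 1 n P = ((2 * Real.cos (((n : ℝ) + 1) * θ) : ℝ) : ℂ) • 1 := by
  rw [centralRepTrunc_eq_qtrLeft, qtrLeft_RR_mul_of_isTruncation h hq hn hP, casVal_eq_cos]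

lemma sMatTrunc_one_left (h : qdiff θ ≠ 0) (hq : qpow θ ((k : ℝ) + 2) = 1) (hn : n ≤ k)
    {P : Matrix (Fin (1 + 1) × Fin (n + 1)) (Fin (1 + 1) × Fin (n + 1)) ℂ}
    (hP : IsTruncation θ k 1 n P) :
    sMatTrunc θ 1 n P = qnum θ (2 * ((n : ℝ) + 1)) := by
  rw [sMatTrunc, qtrLeft_RR_mul_of_isTruncation h hq hn hP, qtr_casVal_smul_one h]

lemma qdiff_ne_zero_of_pos_of_lt_pi (h0 : 0 < θ) (hπ : θ < Real.pi) : qdiff θ ≠ 0 := by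
  have qdiff_mul_I : qdiff θ * Complex.I = ((-(2 * Real.sin θ) : ℝ) : ℂ) := by
    push_cast
    rw [Complex.two_sin, qdiff, qpow, qpow]
    push_cast
    ring_nf
  refine left_ne_zero_of_mul (b := Complex.I) ?_
  rw [qdiff_mul_I, Complex.ofReal_ne_zero, neg_ne_zero]
  exact mul_ne_zero two_ne_zero (Real.sin_pos_of_pos_of_lt_pi h0 hπ).ne'

lemma qdiff_two_pi_div_ne_zero (hk : 1 ≤ k) : qdiff (2 * Real.pi / ((k : ℝ) + 2)) ≠ 0 := by
  refine qdiff_ne_zero_of_pos_of_lt_pi (by positivity) ?_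
  have hk' : (1 : ℝ) ≤ k := Nat.one_le_cast.mpr hk
  rw [div_lt_iff₀ (by positivity)]
  nlinarith [Real.pi_pos]

lemma qpow_two_pi_div (k : ℕ) : qpow (2 * Real.pi / ((k : ℝ) + 2)) ((k : ℝ) + 2) = 1 := by
  rw [qpow, div_mul_cancel₀ _ (by positivity), mul_comm]
  push_cast
  exact Complex.exp_two_pi_mul_I

end RootOfUnity

/-! ### The area spectrum -/

lemma centralRep_one_left (θ : ℝ) (n : ℕ) :
    centralRep θ 1 n = ((2 * Real.cos (((n : ℝ) + 1) * θ) : ℝ) : ℂ) • 1 := by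
  rw [centralRep_eq_qtrLeft, qtrLeft_RR_one_left, casVal_eq_cos]

lemma sMat_one_left {θ : ℝ} (h : qdiff θ ≠ 0) (n : ℕ) :
    sMat θ 1 n = qnum θ (2 * ((n : ℝ) + 1)) := by
  rw [sMat, qtrLeft_RR_one_left, qtr_casVal_smul_one h]

lemma centralRep_one_left_eq_qnum_div {θ : ℝ} {n : ℕ} (hq : qnum θ ((n : ℝ) + 1) ≠ 0) :
    centralRep θ 1 n = (qnum θ (2 * ((n : ℝ) + 1)) / qnum θ ((n : ℝ) + 1)) • 1 := by
  rw [centralRep_eq_qtrLeft, qtrLeft_RR_one_left, qnum_two_mul, mul_div_cancel_right₀ _ hq, casVal]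

lemma areaSpec_smul_one {Λ : ℝ} (hΛ : Λ ≠ 0) (n : ℕ) {φ ψ : ℝ} (hψ : ψ ∈ Set.Icc 0 Real.pi)
    (hcos : Real.cos ψ = Real.cos φ) :
    areaSpec Λ (((2 * Real.cos φ : ℝ) : ℂ) • (1 : Matrix (Fin (n + 1)) (Fin (n + 1)) ℂ)) =
      {6 / |Λ| * ψ} := by
  have spectrum_eq : spectrum ℂ ((1 / 2 : ℂ) • (((2 * Real.cos φ : ℝ) : ℂ) •
      (1 : Matrix (Fin (n + 1)) (Fin (n + 1)) ℂ))) = {((Real.cos φ : ℝ) : ℂ)} := by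
    rw [smul_smul, Complex.ofReal_mul, Complex.ofReal_ofNat, one_div,
      inv_mul_cancel_left₀ two_ne_zero, ← Algebra.algebraMap_eq_smul_one, spectrum.scalar_eq]
  ext x
  rw [areaSpec, Set.mem_ofPred_eq, spectrum_eq, Set.mem_singleton_iff, Set.mem_singleton_iff,
    Complex.ofReal_inj, ← hcos]
  have hΛ' : |Λ| ≠ 0 := abs_ne_zero.mpr hΛ
  constructor
  · rintro ⟨hx, hcos_eq⟩
    rw [← Real.injOn_cos hx hψ hcos_eq]
    field_simp
  · rintro rfl
    have rescale : |Λ| / 6 * (6 / |Λ| * ψ) = ψ := by field_simp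
    rw [rescale]
    exact ⟨hψ, rfl⟩

lemma lt_half_mul_div_sub_one_iff {θ : ℝ} (hθ : 0 < θ) {K c : ℝ} :
    K < 1 / 2 * (c / θ - 1) ↔ (2 * K + 1) * θ < c := by
  rw [← lt_div_iff₀ hθ]
  constructor <;> intro <;> linarith

section

variable {Λ θ K : ℝ}

lemma areaSpec_smul_one_of_lt (hΛ : Λ ≠ 0) (hθ : 0 < θ) (n : ℕ) (hK0 : 0 ≤ K)
    (hK : K < 1 / 2 * (Real.pi / θ - 1)) :
    areaSpec Λ (((2 * Real.cos ((2 * K + 1) * θ) : ℝ) : ℂ) •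
      (1 : Matrix (Fin (n + 1)) (Fin (n + 1)) ℂ)) = {6 / |Λ| * ((2 * K + 1) * θ)} :=
  areaSpec_smul_one hΛ n ⟨by positivity, ((lt_half_mul_div_sub_one_iff hθ).mp hK).le⟩ rfl

lemma areaSpec_smul_one_of_ge (hΛ : Λ ≠ 0) (hθ : 0 < θ) (n : ℕ)
    (hK : 1 / 2 * (Real.pi / θ - 1) ≤ K) (hK' : K < 1 / 2 * (2 * Real.pi / θ - 1)) :
    areaSpec Λ (((2 * Real.cos ((2 * K + 1) * θ) : ℝ) : ℂ) •
      (1 : Matrix (Fin (n + 1)) (Fin (n + 1)) ℂ)) =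
      {6 / |Λ| * (2 * Real.pi - (2 * K + 1) * θ)} := by
  rw [← not_lt, lt_half_mul_div_sub_one_iff hθ, not_lt] at hK
  rw [lt_half_mul_div_sub_one_iff hθ] at hK'
  exact areaSpec_smul_one hΛ n ⟨by linarith, by linarith⟩ (Real.cos_two_pi_sub _)

lemma areaSpec_smul_one_two_pi_div (hΛ : Λ ≠ 0) (n : ℕ) {k : ℕ} (hK0 : 0 ≤ K) (hK : K ≤ k / 2)
    {D : Matrix (Fin (n + 1)) (Fin (n + 1)) ℂ}
    (hD : D = ((2 * Real.cos ((2 * K + 1) * (2 * Real.pi / (k + 2))) : ℝ) : ℂ) • 1) :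
    (K < k / 4 → areaSpec Λ D = {6 / |Λ| * ((2 * K + 1) * (2 * Real.pi / (k + 2)))}) ∧
    ((k : ℝ) / 4 ≤ K →
      areaSpec Λ D = {6 / |Λ| * (2 * Real.pi - (2 * K + 1) * (2 * Real.pi / (k + 2)))}) := by
  have pi_div : 1 / 2 * (Real.pi / (2 * Real.pi / ((k : ℝ) + 2)) - 1) = k / 4 := by
    field_simp; ring
  have two_pi_div : 1 / 2 * (2 * Real.pi / (2 * Real.pi / ((k : ℝ) + 2)) - 1) = (k + 1) / 2 := by
    field_simp; ring
  subst hD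
  refine ⟨fun hlt => areaSpec_smul_one_of_lt hΛ (by positivity) n hK0 (pi_div.symm ▸ hlt),
    fun hge => areaSpec_smul_one_of_ge hΛ (by positivity) n (pi_div.symm ▸ hge) ?_⟩
  rw [two_pi_div]
  linarith

end

end

theorem mainTheorem2 (Λ : ℝ) (hΛ : Λ ≠ 0) :
    -- `q = exp (i θ)` and spin `K = n / 2`
    (∀ θ : ℝ, 0 < θ → θ < 2 * Real.pi → ∀ n : ℕ, ∀ K : ℝ, K = n / 2 →
      centralRep θ 1 n = ((2 * Real.cos ((2 * K + 1) * θ) : ℝ) : ℂ) • 1 ∧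
      (qnum θ (2 * K + 1) ≠ 0 →
        qdim θ n = qnum θ (2 * K + 1) ∧
        sMat θ 1 n = qnum θ (2 * (2 * K + 1)) ∧
        centralRep θ 1 n = (qnum θ (2 * (2 * K + 1)) / qnum θ (2 * K + 1)) • 1) ∧
      (K < 1 / 2 * (Real.pi / θ - 1) →
        areaSpec Λ (centralRep θ 1 n) = {6 / |Λ| * ((2 * K + 1) * θ)}) ∧
      (1 / 2 * (Real.pi / θ - 1) ≤ K → K < 1 / 2 * (2 * Real.pi / θ - 1) →
        areaSpec Λ (centralRep θ 1 n) = {6 / |Λ| * (2 * Real.pi - (2 * K + 1) * θ)})) ∧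
    -- `q = exp (2 π i / (k + 2))` and spin `K = n / 2 ≤ k / 2`, without and with truncation
    (∀ k n : ℕ, ∀ θ K : ℝ, θ = 2 * Real.pi / (k + 2) → K = n / 2 → K ≤ k / 2 →
      (K < k / 4 →
        areaSpec Λ (centralRep θ 1 n) =
          {6 / |Λ| * ((2 * K + 1) * (2 * Real.pi / (k + 2)))}) ∧
      ((k : ℝ) / 4 ≤ K →
        areaSpec Λ (centralRep θ 1 n) =
          {6 / |Λ| * (2 * Real.pi - (2 * K + 1) * (2 * Real.pi / (k + 2)))}) ∧
      (1 ≤ k →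
        (∃ P, IsTruncation θ k 1 n P) ∧
        ∀ P, IsTruncation θ k 1 n P →
          centralRepTrunc θ 1 n P = ((2 * Real.cos ((2 * K + 1) * θ) : ℝ) : ℂ) • 1 ∧
          sMatTrunc θ 1 n P = qnum θ (2 * (2 * K + 1)) ∧
          (K < k / 4 →
            areaSpec Λ (centralRepTrunc θ 1 n P) =
              {6 / |Λ| * ((2 * K + 1) * (2 * Real.pi / (k + 2)))}) ∧
          ((k : ℝ) / 4 ≤ K →
            areaSpec Λ (centralRepTrunc θ 1 n P) =
              {6 / |Λ| * (2 * Real.pi - (2 * K + 1) * (2 * Real.pi / (k + 2)))}))) := by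
  refine ⟨fun θ hθ _ n K hK => ?_, fun k n θ K hθ hK hKk => ?_⟩ <;>
    have hn : (n : ℝ) + 1 = 2 * K + 1 := by rw [hK, mul_div_cancel₀ _ two_ne_zero]
  · have hD := hn ▸ centralRep_one_left θ n
    have hK0 : 0 ≤ K := hK ▸ by positivity
    refine ⟨hD, fun hq => ?_, fun hlt => ?_, fun hge hlt => ?_⟩
    · rw [← hn] at hq ⊢
      have hqdiff := qdiff_ne_zero_of_qnum_ne_zero hq
      exact ⟨qdim_eq_qnum hqdiff n, sMat_one_left hqdiff n, centralRep_one_left_eq_qnum_div hq⟩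
    · rw [hD, areaSpec_smul_one_of_lt hΛ hθ n hK0 hlt]
    · rw [hD, areaSpec_smul_one_of_ge hΛ hθ n hge hlt]
  · subst hθ
    have hnk : n ≤ k := by
      rw [hK, div_le_div_iff_of_pos_right two_pos] at hKk
      exact_mod_cast hKk
    have hK0 : 0 ≤ K := hK ▸ by positivity
    have area {D : Matrix (Fin (n + 1)) (Fin (n + 1)) ℂ} :=
      areaSpec_smul_one_two_pi_div (D := D) hΛ n hK0 hKk
    have hq := qpow_two_pi_div k
    obtain ⟨hlt, hge⟩ := area (hn ▸ centralRep_one_left _ n)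
    refine ⟨hlt, hge, fun hk => ?_⟩
    have h := qdiff_two_pi_div_ne_zero hk
    refine ⟨exists_isTruncation h hq hnk, fun P hP => ?_⟩
    have hD := hn ▸ centralRepTrunc_one_left h hq hnk hP
    exact ⟨hD, hn ▸ sMatTrunc_one_left h hq hnk hP, area hD⟩
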